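/- Let $(\Lambda,\mathcal E)$ be a finite simple graph, $\beta\ge 0$, $u\in[0,1]$, $S\in\tfrac12\mathbb N$. On $\bigotimes_{x\in\Lambda}\mathbb C^{2S+1}$, with the basis $|\sigma\rangle$, $\sigma\in\{-S,\dots,S\}^\Lambda$, in which all third spin components $S^3_x$ are diagonal, consider $$H=-\sum_{\{x,y\}\in\mathcal E}\bigl(u\,T_{xy}+(1-u)\,Q_{xy}-1\bigr),\qquad T_{xy}|a,b\rangle=|b,a\rangle,\qquad \langle a,b|Q_{xy}|c,d\rangle=\delta_{a,b}\,\delta_{c,d},$$ and let $Z=\operatorname{Tr}e^{-\beta H}$ and $\langle M\rangle=Z^{-1}\operatorname{Tr}\bigl(M e^{-\beta H}\bigr)$. For operators $A,B$ on $\mathbb C^{2S+1}$ let $A_x$, $B_y$ denote their actions at the sites $x$, $y$ (the identity elsewhere), let $\operatorname{tr}$ be the trace on $\mathbb C^{2S+1}$, and let $B^{\rm t}$ be the transpose of $B$ in the basis in which $S^3$ is diagonal. Let $\rho$ be the law of independent Poisson point processes on $\mathcal E\times[0,\beta]$ of crosses (intensity $u$) and double bars (intensity $1-u$). For a realization $\omega$,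 let $\mathcal L(\omega)$ be the set of loops in $\Lambda\times[0,\beta]$, with times $0$ and $\beta$ identified: a loop runs vertically until it meets a link (a cross or a double bar) at its site, then jumps to the other endpoint of the edge; at a cross it keeps its vertical direction, and at a double bar it stays on the same side of the bar and reverses its vertical direction. Let $E^+_{xy}$ (resp. $E^-_{xy}$) be the event that $(x,0)$ and $(y,0)$ lie on the same loop, with identical (resp. opposite) vertical directions at these points. Let $E_{xy}=E^+_{xy}\cup E^-_{xy}$, and let $E^{\rm c}_{xy}$ be its complement. **Theorem.** The measure $\mathbb P=Z^{-1}(2S+1)^{|\mathcal L(\omega)|}\rho({\rm d}\omega)$ is a probability measure. For $x\ne y$ the sets $E^\pm_{xy}$ are measurable up to $\mathbb P$-null sets, and for all operators $A,B$ on $\mathbb C^{2S+1}$, $$\langle A_xB_y\rangle=\frac{\operatorname{tr}AB}{2S+1}\,\mathbb P(E^+_{xy})+\frac{\operatorname{tr}AB^{\rm t}}{2S+1}\,\mathbb P(E^-_{xy})+\frac{\operatorname{tr}A\,\operatorname{tr}B}{(2S+1)^2}\,\mathbb P(E^{\rm c}_{xy}).$$ Moreover $\langle A_x\rangle=\frac{\operatorname{tr}A}{2S+1}$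 for every site $x$ and every operator $A$ on $\mathbb C^{2S+1}$. If $S=\tfrac12$ and $S^1,S^2,S^3$ are the standard spin matrices (half the Pauli matrices), then for $x\ne y$ $$\langle S^i_xS^i_y\rangle=\tfrac14\,\mathbb P(E_{xy})\ \ (i=1,3),\qquad \langle S^2_xS^2_y\rangle=\tfrac14\bigl[\mathbb P(E^+_{xy})-\mathbb P(E^-_{xy})\bigr].$$ -/

import Mathlib

open MeasureTheory Set
open scoped ENNReal Matrix Nat

namespace RandomLoop

noncomputable section

/-! ### Quantum spins

Throughout, `d = 2 S + 1` is the dimension of the one-site space.  The classical configurations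
`σ : V → Fin d` form the standard basis of the tensor product of `V` copies of `ℂ ^ d` (the basis in
which all third spin components are diagonal), and operators are written as matrices in it: the
entry `M σ τ` is `⟨σ| M |τ⟩`. -/

section Operators

variable {V : Type*} [Fintype V] [DecidableEq V] {d : ℕ}

/-- Operators on the tensor product of `V` copies of `ℂ ^ d`. -/
abbrev Op (V : Type*) (d : ℕ) := Matrix (V → Fin d) (V → Fin d) ℂ

/-- The operator that acts as `A` at the site `x` and as the identity at the other sites. -/
def siteOp (x : V) (A : Matrix (Fin d) (Fin d) ℂ) : Op V d :=
  fun σ τ => if ∀ z, z ≠ x → σ z = τ z then A (σ x) (τ x) else 0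

/-- The transposition operator: it exchanges the spins at `x` and `y`. -/
def transpositionOp (x y : V) : Op V d :=
  fun σ τ => if σ = τ ∘ Equiv.swap x y then 1 else 0

/-- The operator with `⟨a, b| Q |c, e⟩ = δ_{a b} δ_{c e}` at the sites `x, y`, and which is the
identity at the other sites. -/
def doubleBarOp (x y : V) : Op V d :=
  fun σ τ => if σ x = σ y ∧ τ x = τ y ∧ ∀ z, z ≠ x → z ≠ y → σ z = τ z then 1 else 0

theorem transpositionOp_comm (x y : V) :
    (transpositionOp x y : Op V d) = transpositionOp y x := by
  unfold transpositionOp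
  rw [Equiv.swap_comm]

theorem doubleBarOp_comm (x y : V) : (doubleBarOp x y : Op V d) = doubleBarOp y x := by
  funext σ τ
  unfold doubleBarOp
  congr 1
  apply propext
  constructor <;> rintro ⟨h1, h2, h3⟩ <;> exact ⟨h1.symm, h2.symm, fun z hx hy => h3 z hy hx⟩

/-- The interaction `u T + (1 - u) Q - 1` of an edge. -/
def edgeOp (d : ℕ) (u : ℝ) : Sym2 V → Op V d :=
  Sym2.lift ⟨fun x y => (u : ℂ) • transpositionOp x y + ((1 - u : ℝ) : ℂ) • doubleBarOp x y - 1,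
    fun x y => by simp only [transpositionOp_comm x y, doubleBarOp_comm x y]⟩

/-- The Hamiltonian `- ∑ (u T + (1 - u) Q - 1)` (sum over the edges), without external field. -/
def hamiltonian (G : SimpleGraph V) [DecidableRel G.Adj] (d : ℕ) (u : ℝ) : Op V d :=
  -∑ e ∈ G.edgeFinset, edgeOp d u e

/-- The Gibbs operator `exp (- β H)`. -/
def gibbsOp (G : SimpleGraph V) [DecidableRel G.Adj] (d : ℕ) (β u : ℝ) : Op V d :=
  NormedSpace.exp (-((β : ℂ) • hamiltonian G d u))

/-- The partition function `Tr exp (- β H)`. -/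
def partitionFunction (G : SimpleGraph V) [DecidableRel G.Adj] (d : ℕ) (β u : ℝ) : ℂ :=
  (gibbsOp G d β u).trace

/-- The Gibbs state `⟨M⟩ = Tr (M exp (- β H)) / Tr exp (- β H)`. -/
def gibbsState (G : SimpleGraph V) [DecidableRel G.Adj] (d : ℕ) (β u : ℝ) (M : Op V d) : ℂ :=
  (M * gibbsOp G d β u).trace / partitionFunction G d β u

end Operators

/-- The first spin operator for spin 1/2, in the basis `|1/2⟩, |-1/2⟩`. -/
def spinHalf1 : Matrix (Fin 2) (Fin 2) ℂ := !![0, 1 / 2; 1 / 2, 0]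

/-- The second spin operator for spin 1/2. -/
def spinHalf2 : Matrix (Fin 2) (Fin 2) ℂ := !![0, -Complex.I / 2; Complex.I / 2, 0]

/-- The third spin operator for spin 1/2. -/
def spinHalf3 : Matrix (Fin 2) (Fin 2) ℂ := !![1 / 2, 0; 0, -1 / 2]

/-! ### Poisson point measures -/

/-- The law of the Poisson point process whose intensity is the finite measure `μ`: the number of
points has the Poisson distribution of parameter `μ univ` and, given that number, the points are
independent with law `μ / μ univ`.  A realization is a finite family of points. -/
def poissonLaw {X : Type*} [MeasurableSpace X] (μ : Measure X) :
    Measure (Σ n : ℕ, (Fin n → X)) :=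
  Measure.sum fun n : ℕ =>
    (ENNReal.ofReal (Real.exp (-(μ univ).toReal)) / (n ! : ℝ≥0∞)) •
      (Measure.pi fun _ : Fin n => μ).map (Sigma.mk n)

/-- The two kinds of links. -/
inductive LinkKind where
  | cross : LinkKind
  | bar : LinkKind

instance : MeasurableSpace LinkKind := ⊤

section Loops

variable {V : Type*}

/-- The (finite, discrete) set of edges of a graph. -/
abbrev Edge (G : SimpleGraph V) := {e : Sym2 V // e ∈ G.edgeSet}

instance (G : SimpleGraph V) : MeasurableSpace (Edge G) := ⊤

/-- A link: an edge, a kind (cross or double bar), and a time. -/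
abbrev Link (G : SimpleGraph V) := Edge G × LinkKind × ℝ

/-- A realization of the Poisson point measure: a finite family of links. -/
abbrev Realization (G : SimpleGraph V) := Σ n : ℕ, (Fin n → Link G)

/-- On every edge, crosses have intensity `u dt` and double bars have intensity `(1 - u) dt`, on
the time interval `[0, β]`. -/
def linkIntensity (G : SimpleGraph V) (β u : ℝ) : Measure (Link G) :=
  (Measure.count : Measure (Edge G)).prod
    ((ENNReal.ofReal u • Measure.dirac LinkKind.cross +
        ENNReal.ofReal (1 - u) • Measure.dirac LinkKind.bar).prod
      (volume.restrict (Icc (0 : ℝ) β)))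

/-- The Poisson point measure `ρ` of crosses and double bars. -/
def rho (G : SimpleGraph V) (β u : ℝ) : Measure (Realization G) :=
  poissonLaw (linkIntensity G β u)

/-! ### Loops

Let `η` be the set of links of a realization.  A triple `(x, t, b)` is a space-time point with a
vertical direction: `b = true` is upwards, `b = false` is downwards. -/

/-- No link of `η` touches the site `x` at a time in `I`. -/
def Clear {G : SimpleGraph V} (η : Set (Link G)) (x : V) (I : Set ℝ) : Prop :=
  ∀ l ∈ η, x ∈ (l.1 : Sym2 V) → l.2.2 ∉ I

/-- Elementary moves along the loops of `η`.  One can move vertically; times `0` and `β` are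
identified; at a cross, one jumps to the other endpoint of the edge and keeps the vertical
direction; at a double bar, one jumps to the other endpoint of the edge, on the same side of the
double bar, and reverses the vertical direction. -/
inductive Move {G : SimpleGraph V} (β : ℝ) (η : Set (Link G)) :
    V × ℝ × Bool → V × ℝ × Bool → Prop
  | vertical (x : V) (s t : ℝ) (b : Bool) (hs : 0 ≤ s) (hst : s ≤ t) (ht : t ≤ β)
      (hx : Clear η x (Icc s t)) : Move β η (x, s, b) (x, t, b)
  | periodic (x : V) (b : Bool) : Move β η (x, 0, b) (x, β, b)
  | cross (e : Edge G) (r : ℝ) (hl : (e, LinkKind.cross, r) ∈ η) (x y : V)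
      (he : (e : Sym2 V) = s(x, y)) (s t : ℝ) (b : Bool) (hs : 0 ≤ s) (hsr : s < r)
      (hrt : r < t) (ht : t ≤ β) (hx : Clear η x (Ico s r)) (hy : Clear η y (Ioc r t)) :
      Move β η (x, s, b) (y, t, b)
  | barBelow (e : Edge G) (r : ℝ) (hl : (e, LinkKind.bar, r) ∈ η) (x y : V)
      (he : (e : Sym2 V) = s(x, y)) (s t : ℝ) (b : Bool) (hs : 0 ≤ s) (hsr : s < r)
      (ht : 0 ≤ t) (htr : t < r) (hx : Clear η x (Ico s r)) (hy : Clear η y (Ico t r)) :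
      Move β η (x, s, b) (y, t, !b)
  | barAbove (e : Edge G) (r : ℝ) (hl : (e, LinkKind.bar, r) ∈ η) (x y : V)
      (he : (e : Sym2 V) = s(x, y)) (s t : ℝ) (b : Bool) (hrs : r < s) (hs : s ≤ β)
      (hrt : r < t) (ht : t ≤ β) (hx : Clear η x (Ioc r s)) (hy : Clear η y (Ioc r t)) :
      Move β η (x, s, b) (y, t, !b)

/-- `Connected β η (x, s, b) (y, t, c)`: the loop that contains `(x, s)` also contains `(y, t)`,
and when it is followed so that it has vertical direction `b` at `(x, s)`, it has vertical
direction `c` at `(y, t)`. -/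
def Connected {G : SimpleGraph V} (β : ℝ) (η : Set (Link G)) :
    V × ℝ × Bool → V × ℝ × Bool → Prop :=
  Relation.EqvGen (Move β η)

/-- The points of `V × [0, β]` away from the links. -/
def regularPoints {G : SimpleGraph V} (β : ℝ) (η : Set (Link G)) : Set (V × ℝ) :=
  {p | p.2 ∈ Icc 0 β ∧ Clear η p.1 {p.2}}

/-- The loop that contains the point `p` (as a set of points away from the links). -/
def loopThrough {G : SimpleGraph V} (β : ℝ) (η : Set (Link G)) (p : V × ℝ) : Set (V × ℝ) :=
  {q | q ∈ regularPoints β η ∧ ∃ b, Connected β η (p.1, p.2, true) (q.1, q.2, b)}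

/-- The set of all loops. -/
def loops {G : SimpleGraph V} (β : ℝ) (η : Set (Link G)) : Set (Set (V × ℝ)) :=
  loopThrough β η '' regularPoints β η

/-- The number of loops of a realization. -/
def numLoops {G : SimpleGraph V} (β : ℝ) (ω : Realization G) : ℕ :=
  (loops β (range ω.2)).ncard

/-- The event that `x` and `y` (at time `0`) belong to the same loop, with identical vertical
direction. -/
def eventPlus (G : SimpleGraph V) (β : ℝ) (x y : V) : Set (Realization G) :=
  {ω | Connected β (range ω.2) (x, 0, true) (y, 0, true)}

/-- The event that `x` and `y` (at time `0`) belong to the same loop, with opposite vertical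
directions. -/
def eventMinus (G : SimpleGraph V) (β : ℝ) (x y : V) : Set (Realization G) :=
  {ω | Connected β (range ω.2) (x, 0, true) (y, 0, false)}

/-- The event that `x` and `y` (at time `0`) belong to the same loop. -/
def eventSame (G : SimpleGraph V) (β : ℝ) (x y : V) : Set (Realization G) :=
  eventPlus G β x y ∪ eventMinus G β x y

/-- The random loop measure `Z⁻¹ d ^ (number of loops) ρ(dω)`, where `Z` is the partition
function of the quantum system. -/
def loopMeasure [Fintype V] [DecidableEq V] (G : SimpleGraph V) [DecidableRel G.Adj] (d : ℕ)
    (β u : ℝ) : Measure (Realization G) :=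
  ENNReal.ofReal (partitionFunction G d β u).re⁻¹ •
    (rho G β u).withDensity fun ω => (d : ℝ≥0∞) ^ numLoops β ω

end Loops

end

end RandomLoop

open RandomLoop

/-! In the classical basis the operators of a cross and of a double bar are 0/1 matrices: an entry
is 1 exactly when the configurations before and after the link agree along the lines that the link
joins. Expanding `exp (-β H)` in powers, with the constant `-1` of each edge producing the factor
`exp (-β |E|)`, writes `Tr (M exp (-β H))` as a sum over words of links. The coefficient `wordMass`
of a word is the probability that it is the time-ordered word of the Poisson realization
(`hasSum_trace_mul_gibbsOp`, `lintegral_rho`). It remains to evaluate the trace of `M` against a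
single word.

Such a trace is a sum over colourings of the segments of the lines. For `M = 1` there is one free
colour per loop, hence `d ^ (number of loops)`. The operator `A_x B_y` cuts the loops at `(x, 0)`
and `(y, 0)`, and the four cut ends are joined in pairs by the remaining pieces (`exists_partner`).
If the two sides of the cut at `x` are still joined to each other, the loops are different and the
traces factor. Otherwise an end at `x` is joined to an end at `y`: opposite sides of the cuts give
`tr AB` (same direction), equal sides give `tr ABᵗ` (opposite directions). This is
`colouringSum_two_cut`; the power of `d` is found by comparison with `A = B = 1`, where the cuts
heal.

Finally, almost surely the link times are distinct and lie in `(0, β)`. Then the loops in continuous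
time are the orbits, up to orientation, of a permutation attached to the word (`connected_iff`,
`ncard_loops`). The events and the number of loops thus agree almost everywhere with measurable
functions of the word, which gives null measurability and turns probabilities into the same series
as the traces. -/

namespace RandomLoop

/-! ### Matchings of the ends of finitely many segments

`α` exchanges the two ends of a segment, `γ` is a gluing of the ends. The permutation `γ * α`
follows a segment from one end to the other and jumps to the end glued to it. -/

section Matching

variable {D : Type*} (α γ : Equiv.Perm D)

/-- The equivalence relation generated by `α`, and by `γ` away from `S`: the connected components
once the gluings of the points of `S` have been cut. -/
def cutSetoid (S : Set D) : Setoid D :=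
  Relation.EqvGen.setoid fun p q => q = α p ∨ (p ∉ S ∧ q = γ p)

variable {α γ}

theorem cutSetoid_alpha (S : Set D) (p : D) : cutSetoid α γ S p (α p) :=
  Relation.EqvGen.rel _ _ (Or.inl rfl)

theorem cutSetoid_gamma {S : Set D} {p : D} (hp : p ∉ S) : cutSetoid α γ S p (γ p) :=
  Relation.EqvGen.rel _ _ (Or.inr ⟨hp, rfl⟩)

/-- A predicate that is invariant under the generating moves is invariant under `cutSetoid`. -/
theorem cutSetoid_induction {S : Set D} {P : D → Prop}
    (h1 : ∀ p, P p ↔ P (α p)) (h2 : ∀ p ∉ S, (P p ↔ P (γ p)))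
    {p q : D} (hpq : cutSetoid α γ S p q) : P p ↔ P q := by
  induction (show Relation.EqvGen _ p q from hpq) with
  | rel a b hab =>
    rcases hab with rfl | ⟨h3, rfl⟩
    · exact h1 _
    · exact h2 _ h3
  | refl a => rfl
  | symm a b _ ih => exact (ih ‹_›).symm
  | trans a b c _ _ ih1 ih2 => exact (ih1 ‹_›).trans (ih2 ‹_›)

/-- An equivalence relation that contains the graph of a permutation contains its cycles. -/
theorem rel_of_sameCycle {f : Equiv.Perm D} {r : Setoid D} (h : ∀ p, r p (f p)) {p q : D}
    (hpq : f.SameCycle p q) : r p q := by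
  obtain ⟨k, rfl⟩ := hpq
  induction k using Int.induction_on with
  | zero => exact r.refl _
  | succ k ih =>
    refine r.trans ih ?_
    rw [add_comm, zpow_add, zpow_one]
    exact h _
  | pred k ih =>
    refine r.trans ih (r.symm ?_)
    have h' : f ((f ^ (-(k : ℤ) - 1)) p) = (f ^ (-(k : ℤ))) p := by
      rw [← Equiv.Perm.mul_apply, ← zpow_one_add]
      congr 2
      ring
    rw [← h']
    exact h _

variable (hα : ∀ p, α (α p) = p) (hγ : ∀ p, γ (γ p) = p)
include hα hγ

/-- Since `α` and `γ` are involutions, conjugation by `α` inverts `γ * α`: flipping an end reverses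
the direction of travel. -/
theorem alpha_zpow_apply (k : ℤ) (p : D) :
    α (((γ * α) ^ k) p) = ((γ * α) ^ (-k)) (α p) := by
  have hα' : α * α = 1 := Equiv.ext hα
  have hγ' : γ * γ = 1 := Equiv.ext hγ
  have h1 : SemiconjBy α (γ * α) (γ * α)⁻¹ := by
    unfold SemiconjBy
    rw [eq_inv_mul_iff_mul_eq]
    calc γ * α * (α * (γ * α)) = γ * (α * α) * γ * α := by simp only [mul_assoc]
      _ = α := by rw [hα', mul_one, hγ', one_mul]
  have h2 := (h1.zpow_right k).eq
  have h3 := congrArg (fun e : Equiv.Perm D => e p) h2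
  rw [zpow_neg, ← inv_zpow]
  exact h3

theorem sameCycle_alpha {p q : D} (h : (γ * α).SameCycle p q) :
    (γ * α).SameCycle (α p) (α q) := by
  obtain ⟨k, rfl⟩ := h
  exact ⟨-k, (alpha_zpow_apply hα hγ k p).symm⟩

/-- A loop never comes back to a point with the opposite orientation. -/
theorem not_sameCycle_alpha (hα' : ∀ p, α p ≠ p) (hγ' : ∀ p, γ p ≠ p) (p : D) :
    ¬ (γ * α).SameCycle p (α p) := by
  rintro ⟨k, hk⟩
  -- Look halfway along the path from `p` to `α p`: for even `k` the midpoint is fixed by `α`, for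
  -- odd `k` its flip is fixed by `γ`.
  rcases Int.even_or_odd' k with ⟨j, rfl | rfl⟩
  · apply hα' (((γ * α) ^ j) p)
    rw [alpha_zpow_apply hα hγ, ← hk, ← Equiv.Perm.mul_apply, ← zpow_add]
    congr 2
    ring
  · apply hγ' (α (((γ * α) ^ j) p))
    have h1 : γ (α (((γ * α) ^ j) p)) = ((γ * α) ^ (1 + j)) p := by
      rw [zpow_add, zpow_one]; rfl
    rw [h1, alpha_zpow_apply hα hγ, ← hk, ← Equiv.Perm.mul_apply, ← zpow_add]
    congr 2
    ring

/-- Forgetting the orientation merges the orbit of `p` with that of `α p`; their union is stable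
under both `α` and `γ`. -/
theorem cutSetoid_empty_iff {p q : D} : cutSetoid α γ ∅ p q ↔
    (γ * α).SameCycle p q ∨ (γ * α).SameCycle p (α q) := by
  have hf : ∀ p, (γ * α) (α p) = γ p := fun p => by simp [hα]
  constructor
  · intro h
    have key : ∀ r, ((γ * α).SameCycle p r ∨ (γ * α).SameCycle p (α r)) ↔
        ((γ * α).SameCycle p (γ r) ∨ (γ * α).SameCycle p (α (γ r))) := by
      intro r
      have h1 : (γ * α).SameCycle (γ r) (α r) := by
        rw [← hf]; exact Equiv.Perm.sameCycle_apply_left.2 (Equiv.Perm.SameCycle.refl _ _)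
      have h2 := sameCycle_alpha hα hγ h1
      rw [hα] at h2
      constructor
      · rintro (h | h)
        · exact Or.inr (h.trans h2.symm)
        · exact Or.inl (h.trans h1.symm)
      · rintro (h | h)
        · exact Or.inr (h.trans h1)
        · exact Or.inl (h.trans h2)
    refine (cutSetoid_induction (P := fun r => (γ * α).SameCycle p r ∨ (γ * α).SameCycle p (α r))
      (fun r => ?_) (fun r _ => key r) h).1 (Or.inl (Equiv.Perm.SameCycle.refl _ _))
    simp only [hα]
    exact or_comm
  · have step : ∀ r, cutSetoid α γ ∅ r ((γ * α) r) := fun r =>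
      (cutSetoid α γ ∅).trans (cutSetoid_alpha _ r) (cutSetoid_gamma (Set.notMem_empty _))
    have key : ∀ r, (γ * α).SameCycle p r → cutSetoid α γ ∅ p r := fun r =>
      rel_of_sameCycle step
    rintro (h | h)
    · exact key _ h
    · exact (cutSetoid α γ ∅).trans (key _ h) ((cutSetoid α γ ∅).symm (cutSetoid_alpha _ q))

/-- Each cut component that contains a cut point contains exactly one other cut point. -/
theorem exists_partner [Finite D] (hα' : ∀ p, α p ≠ p) (hγ' : ∀ p, γ p ≠ p) {S : Set D}
    (hS : ∀ p ∈ S, γ p ∈ S) {s : D} (hs : s ∈ S) :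
    ∃ t ∈ S, t ≠ s ∧ cutSetoid α γ S s t ∧ (∀ u ∈ S, cutSetoid α γ S s u → u = s ∨ u = t) ∧
      (γ * α).SameCycle s (γ t) := by
  classical
  -- `m` is the first return time to `S` of the orbit of `s`. The partner is the last end reached
  -- before crossing that cut, `α ((γ * α) ^ (m - 1) s)`.
  have hex : ∃ m : ℕ, 0 < m ∧ ((γ * α) ^ m) s ∈ S := by
    refine ⟨orderOf (γ * α), orderOf_pos _, ?_⟩
    rw [pow_orderOf_eq_one]
    exact hs
  set m := Nat.find hex with hm
  obtain ⟨hm0, hmS⟩ := Nat.find_spec hex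
  rw [← hm] at hm0 hmS
  have hmin : ∀ j, 0 < j → j < m → ((γ * α) ^ j) s ∉ S := fun j hj hjm h =>
    Nat.find_min hex hjm ⟨hj, h⟩
  have hstep : ∀ j, ((γ * α) ^ (j + 1)) s = γ (α (((γ * α) ^ j) s)) := fun j => by
    rw [pow_succ']; rfl
  have hout : ∀ j, j + 1 < m → α (((γ * α) ^ j) s) ∉ S := fun j hj h =>
    hmin (j + 1) (Nat.succ_pos _) hj (by rw [hstep]; exact hS _ h)
  have hcut : ∀ j, j < m → cutSetoid α γ S s (((γ * α) ^ j) s) := by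
    intro j
    induction j with
    | zero => exact fun _ => (cutSetoid α γ S).refl _
    | succ j ih =>
      intro hj
      refine (cutSetoid α γ S).trans (ih (by omega)) ?_
      rw [hstep]
      exact (cutSetoid α γ S).trans (cutSetoid_alpha _ _) (cutSetoid_gamma (hout j hj))
  obtain ⟨m', hm'⟩ : ∃ m', m = m' + 1 := ⟨m - 1, by omega⟩
  have ht : γ (((γ * α) ^ m) s) = α (((γ * α) ^ m') s) := by rw [hm', hstep, hγ]
  refine ⟨γ (((γ * α) ^ m) s), hS _ hmS, ?_, ?_, ?_, ?_⟩
  · rw [ht]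
    intro h
    apply not_sameCycle_alpha hα hγ hα' hγ' (((γ * α) ^ m') s)
    rw [h]
    exact (Equiv.Perm.SameCycle.symm ⟨m', by simp⟩)
  · rw [ht]
    exact (cutSetoid α γ S).trans (hcut m' (by omega)) (cutSetoid_alpha _ _)
  -- The ends met before the first return are stable under `α`, and under `γ` off `S`, so they
  -- contain the whole cut component; only its two extremities lie in `S`.
  · let W : D → Prop := fun p => ∃ j < m, p = ((γ * α) ^ j) s ∨ p = α (((γ * α) ^ j) s)
    have hWα : ∀ p, W p → W (α p) := by
      rintro p ⟨j, hj, rfl | rfl⟩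
      · exact ⟨j, hj, Or.inr rfl⟩
      · exact ⟨j, hj, Or.inl (hα _)⟩
    have hWγ : ∀ p ∉ S, W p → W (γ p) := by
      rintro p hp ⟨j, hj, rfl | rfl⟩
      · cases j with
        | zero => exact absurd hs hp
        | succ j => exact ⟨j, by omega, Or.inr (by rw [hstep, hγ])⟩
      · by_cases hjm : j + 1 < m
        · exact ⟨j + 1, hjm, Or.inl (hstep j).symm⟩
        · obtain rfl : j = m' := by omega
          rw [← ht] at hp
          exact absurd (hS _ hmS) hp
    intro u hu hsu
    have hWu : W u := by
      refine (cutSetoid_induction (P := W) (fun p => ⟨hWα p, fun h => ?_⟩)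
        (fun p hp => ⟨hWγ p hp, fun h => ?_⟩) hsu).1 ⟨0, hm0, Or.inl rfl⟩
      · rw [← hα p]; exact hWα _ h
      · rw [← hγ p]
        exact hWγ _ (fun h' => hp (by rw [← hγ p]; exact hS _ h')) h
    obtain ⟨j, hj, rfl | rfl⟩ := hWu
    · rcases Nat.eq_zero_or_pos j with rfl | hj0
      · exact Or.inl rfl
      · exact absurd hu (hmin j hj0 hj)
    · right
      have : ¬ j + 1 < m := fun h => hout j h hu
      obtain rfl : j = m' := by omega
      exact ht.symm
  · rw [hγ]
    exact ⟨m, by simp⟩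

end Matching

/-! ### Sums over colourings of the components -/

section Colouring

/-- Translating the colour at `c` alone permutes the colourings; summing over the `d` translations
in `Fin d` removes the dependence on `g`. The factor `d` on the left avoids the exponent `Nat.card Q
- 1`. -/
theorem card_mul_sum_apply {Q : Type*} [Fintype Q] [DecidableEq Q] {d : ℕ} (c : Q)
    (F : Fin d → ℂ) :
    (d : ℂ) * ∑ g : Q → Fin d, F (g c) = (d : ℂ) ^ Nat.card Q * ∑ a, F a := by
  rcases Nat.eq_zero_or_pos d with rfl | hd
  · simp
  have : NeZero d := ⟨hd.ne'⟩
  have h1 : ∀ a : Fin d, ∑ g : Q → Fin d, F (g c) = ∑ g : Q → Fin d, F (g c + a) := by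
    intro a
    rw [← Equiv.sum_comp (Equiv.addRight (Pi.single c a : Q → Fin d))]
    simp
  calc (d : ℂ) * ∑ g : Q → Fin d, F (g c) = ∑ a : Fin d, ∑ g : Q → Fin d, F (g c + a) := by
        rw [← Finset.sum_congr rfl fun a _ => h1 a]; simp
    _ = ∑ g : Q → Fin d, ∑ a : Fin d, F a := by
        rw [Finset.sum_comm]
        exact Finset.sum_congr rfl fun g _ => Equiv.sum_comp (Equiv.addLeft (g c)) F
    _ = _ := by simp [Nat.card_eq_fintype_card]

/-- The same averaging, with the colours at two distinct components translated independently. -/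
theorem card_sq_mul_sum_apply {Q : Type*} [Fintype Q] [DecidableEq Q] {d : ℕ} {c₁ c₂ : Q}
    (hc : c₁ ≠ c₂) (F : Fin d → Fin d → ℂ) :
    (d : ℂ) ^ 2 * ∑ g : Q → Fin d, F (g c₁) (g c₂) =
      (d : ℂ) ^ Nat.card Q * ∑ a, ∑ b, F a b := by
  rcases Nat.eq_zero_or_pos d with rfl | hd
  · simp
  have : NeZero d := ⟨hd.ne'⟩
  have h1 : ∀ a b : Fin d, ∑ g : Q → Fin d, F (g c₁) (g c₂) =
      ∑ g : Q → Fin d, F (g c₁ + a) (g c₂ + b) := by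
    intro a b
    rw [← Equiv.sum_comp (Equiv.addRight (Pi.single c₁ a + Pi.single c₂ b : Q → Fin d))]
    simp [hc, hc.symm]
  calc (d : ℂ) ^ 2 * ∑ g : Q → Fin d, F (g c₁) (g c₂)
      = ∑ a : Fin d, ∑ b : Fin d, ∑ g : Q → Fin d, F (g c₁ + a) (g c₂ + b) := by
        rw [← Finset.sum_congr rfl fun a _ => Finset.sum_congr rfl fun b _ => h1 a b]
        simp; ring
    _ = ∑ g : Q → Fin d, ∑ a : Fin d, ∑ b : Fin d, F (g c₁ + a) (g c₂ + b) := by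
        rw [Finset.sum_comm]
        refine (Finset.sum_congr rfl fun a _ => Finset.sum_comm).trans ?_
        rw [Finset.sum_comm]
        rw [Finset.sum_comm]
        rw [Finset.sum_comm]
        refine Finset.sum_congr rfl fun g _ => Finset.sum_comm
    _ = ∑ g : Q → Fin d, ∑ a : Fin d, ∑ b : Fin d, F a b := by
        refine Finset.sum_congr rfl fun g _ => ?_
        rw [← Equiv.sum_comp (Equiv.addLeft (g c₁)) fun a => ∑ b : Fin d, F a b]
        exact Finset.sum_congr rfl fun a _ => Equiv.sum_comp (Equiv.addLeft (g c₂)) (F (g c₁ + a))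
    _ = _ := by simp [Nat.card_eq_fintype_card]

variable {D : Type*} [Fintype D] [DecidableEq D] (α γ : Equiv.Perm D) {d : ℕ}

/-- The colourings that are constant on the components of `cutSetoid α γ S`. -/
def IsColouring (S : Set D) (σ : D → Fin d) : Prop :=
  (∀ p, σ (α p) = σ p) ∧ ∀ p ∉ S, σ (γ p) = σ p

open Classical in
/-- The sum of `F` over the colourings. -/
noncomputable def colouringSum (S : Set D) (F : (D → Fin d) → ℂ) : ℂ :=
  ∑ σ : D → Fin d, if IsColouring α γ S σ then F σ else 0

/-- The number of components of `cutSetoid α γ S`. -/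
noncomputable def numComponents (S : Set D) : ℕ := Nat.card (Quotient (cutSetoid α γ S))

variable {α γ}

omit [Fintype D] [DecidableEq D] in
theorem IsColouring.eq_of_cutSetoid {S : Set D} {σ : D → Fin d} (h : IsColouring α γ S σ)
    {p q : D} (hpq : cutSetoid α γ S p q) : σ p = σ q :=
  ((cutSetoid_induction (P := fun r => σ p = σ r) (fun r => by rw [h.1])
    (fun r hr => by rw [h.2 r hr]) hpq).1 rfl)

open Classical in
theorem colouringSum_eq (S : Set D) (F : (D → Fin d) → ℂ) :
    colouringSum α γ S F =
      ∑ g : Quotient (cutSetoid α γ S) → Fin d, F fun p => g (Quotient.mk _ p) := by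
  symm
  refine Fintype.sum_of_injective (fun g p => g (Quotient.mk _ p)) ?_ _ _ ?_ ?_
  · intro g g' h
    funext q
    induction q using Quotient.inductionOn with
    | h p => exact congrFun h p
  · intro σ hσ
    rw [if_neg]
    intro h
    exact hσ ⟨fun q => Quotient.lift σ (fun a b hab => h.eq_of_cutSetoid hab) q, rfl⟩
  · intro g
    rw [if_pos]
    constructor
    · intro p
      exact congrArg g (Quotient.sound ((cutSetoid α γ S).symm (cutSetoid_alpha S p)))
    · intro p hp
      exact congrArg g (Quotient.sound ((cutSetoid α γ S).symm (cutSetoid_gamma hp)))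

theorem colouringSum_empty_one :
    colouringSum α γ ∅ (fun _ : D → Fin d => 1) = (d : ℂ) ^ numComponents α γ ∅ := by
  classical
  rw [colouringSum_eq, numComponents, Nat.card_eq_fintype_card]
  simp

variable (hα : ∀ p, α (α p) = p) (hγ : ∀ p, γ (γ p) = p) (hα' : ∀ p, α p ≠ p)
  (hγ' : ∀ p, γ p ≠ p)
include hα hγ hα' hγ'

/-- Both sides of the cut lie in one component, so the sum is proportional to `tr A`. The constant
is not found by counting components: at `A = 1` the matrix reglues the cut and gives the uncut sum.
-/
theorem colouringSum_one_cut (hd : 1 ≤ d) (p : D) (A : Matrix (Fin d) (Fin d) ℂ) :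
    (d : ℂ) * colouringSum α γ {p, γ p} (fun σ => A (σ (γ p)) (σ p)) =
      (d : ℂ) ^ numComponents α γ ∅ * A.trace := by
  classical
  set S : Set D := {p, γ p} with hSdef
  have hS : ∀ q ∈ S, γ q ∈ S := by
    rintro q (rfl | rfl)
    · exact Or.inr rfl
    · exact Or.inl (hγ p)
  obtain ⟨t, htS, htp, hpt, -, -⟩ :=
    exists_partner hα hγ hα' hγ' hS (s := p) (Or.inl rfl)
  obtain rfl : t = γ p := by
    rcases htS with h | h
    · exact absurd h htp
    · exact h
  have key : ∀ A : Matrix (Fin d) (Fin d) ℂ,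
      (d : ℂ) * colouringSum α γ S (fun σ => A (σ (γ p)) (σ p)) =
      (d : ℂ) ^ Nat.card (Quotient (cutSetoid α γ S)) * A.trace := by
    intro A
    rw [colouringSum_eq]
    have : (Quotient.mk (cutSetoid α γ S) (γ p)) = Quotient.mk _ p :=
      Quotient.sound ((cutSetoid α γ S).symm hpt)
    simp only [this]
    exact card_mul_sum_apply (Quotient.mk _ p) fun a => A a a
  have h1 : colouringSum α γ S (fun σ => (1 : Matrix (Fin d) (Fin d) ℂ) (σ (γ p)) (σ p)) =
      (d : ℂ) ^ numComponents α γ ∅ := by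
    rw [← colouringSum_empty_one]
    unfold colouringSum
    refine Finset.sum_congr rfl fun σ _ => ?_
    beta_reduce
    by_cases hσ : IsColouring α γ ∅ σ
    · rw [if_pos hσ, if_pos ⟨hσ.1, fun q _ => hσ.2 q (Set.notMem_empty _)⟩,
        hσ.2 p (Set.notMem_empty _), Matrix.one_apply_eq]
    · rw [if_neg hσ, ite_eq_right_iff]
      intro h
      exact absurd ⟨h.1, fun q _ => by
        by_cases hq : q ∈ S
        · rcases hq with rfl | rfl
          · exact (h.eq_of_cutSetoid hpt).symm
          · rw [hγ]; exact h.eq_of_cutSetoid hpt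
        · exact h.2 q hq⟩ hσ
  have h2 := key 1
  rw [h1, Matrix.trace_one, Fintype.card_fin] at h2
  have hd' : (d : ℂ) ≠ 0 := Nat.cast_ne_zero.2 (by omega)
  rw [key A, ← mul_left_cancel₀ hd' (h2.trans (mul_comm _ _))]

-- The partner `t` of `p` among the cut ends decides the case. For `t = γ p` each cut is joined to
-- itself. For `t = q` the components identify `p` with `q` and `γ p` with `γ q`, giving `∑ A b a *
-- B b a`. For `t = γ q` they identify `p` with `γ q` and `q` with `γ p`, giving `∑ A b a * B a b`.
open Classical in
theorem colouringSum_two_cut (hd : 1 ≤ d) {p q : D} (hqp : q ≠ p) (hqp' : q ≠ γ p)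
    (A B : Matrix (Fin d) (Fin d) ℂ) :
    colouringSum α γ {p, γ p, q, γ q}
        (fun σ => A (σ (γ p)) (σ p) * B (σ (γ q)) (σ q)) =
      (d : ℂ) ^ numComponents α γ ∅ *
      ((if (γ * α).SameCycle p q then (A * B).trace / d else 0) +
        (if (γ * α).SameCycle p (α q) then (A * Bᵀ).trace / d else 0) +
        (if ¬ ((γ * α).SameCycle p q ∨ (γ * α).SameCycle p (α q)) then
          A.trace * B.trace / (d : ℂ) ^ 2 else 0)) := by
  have hd' : (d : ℂ) ≠ 0 := Nat.cast_ne_zero.2 (by omega)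
  set S : Set D := {p, γ p, q, γ q} with hSdef
  have hS : ∀ r ∈ S, γ r ∈ S := by
    rintro r (rfl | rfl | rfl | rfl) <;> simp [hSdef, hγ]
  have hαq : (γ * α).SameCycle (α q) (γ q) :=
    ⟨1, by simp [hα]⟩
  have hexcl : (γ * α).SameCycle p q → ¬ (γ * α).SameCycle p (α q) := fun h1 h2 =>
    not_sameCycle_alpha hα hγ hα' hγ' q (h1.symm.trans h2)
  have hpS : p ∈ S := by simp [hSdef]
  have hpS' : γ p ∈ S := by simp [hSdef]
  have hqS : q ∈ S := by simp [hSdef]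
  have hqS' : γ q ∈ S := by simp [hSdef]
  obtain ⟨t, htS, htp, hpt, hpu, hcyc⟩ := exists_partner hα hγ hα' hγ' hS hpS
  have h1 : colouringSum α γ S (fun σ => (1 : Matrix (Fin d) (Fin d) ℂ) (σ (γ p)) (σ p) *
      (1 : Matrix (Fin d) (Fin d) ℂ) (σ (γ q)) (σ q)) = (d : ℂ) ^ numComponents α γ ∅ := by
    rw [← colouringSum_empty_one]
    unfold colouringSum
    refine Finset.sum_congr rfl fun σ _ => ?_
    beta_reduce
    by_cases hσ : IsColouring α γ ∅ σ
    · rw [if_pos hσ, if_pos ⟨hσ.1, fun q _ => hσ.2 q (Set.notMem_empty _)⟩,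
        hσ.2 p (Set.notMem_empty _), hσ.2 q (Set.notMem_empty _), Matrix.one_apply_eq,
        Matrix.one_apply_eq, one_mul]
    · rw [if_neg hσ, ite_eq_right_iff]
      intro h
      rw [Matrix.one_apply, Matrix.one_apply]
      by_contra h3
      have hp3 : σ (γ p) = σ p := by by_contra h4; simp [h4] at h3
      have hq3 : σ (γ q) = σ q := by by_contra h4; simp [h4] at h3
      refine hσ ⟨h.1, fun r _ => ?_⟩
      by_cases hr : r ∈ S
      · rcases hr with rfl | rfl | rfl | rfl
        · exact hp3
        · rw [hγ]; exact hp3.symm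
        · exact hq3
        · rw [hγ]; exact hq3.symm
      · exact h.2 r hr
  set T : Matrix (Fin d) (Fin d) ℂ → Matrix (Fin d) (Fin d) ℂ → ℂ := fun A B =>
    colouringSum α γ S (fun σ => A (σ (γ p)) (σ p) * B (σ (γ q)) (σ q)) with hT
  have hTdef : ∀ A B, T A B = ∑ g : Quotient (cutSetoid α γ S) → Fin d,
      A (g (Quotient.mk _ (γ p))) (g (Quotient.mk _ p)) *
        B (g (Quotient.mk _ (γ q))) (g (Quotient.mk _ q)) := fun A B => by
    rw [hT]; exact colouringSum_eq _ _
  change T 1 1 = _ at h1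
  change T A B = _
  have mk_eq : ∀ {a b : D}, cutSetoid α γ S a b →
      (Quotient.mk (cutSetoid α γ S) a) = Quotient.mk _ b := fun h => Quotient.sound h
  have mk_ne : ∀ {a b : D}, ¬ cutSetoid α γ S a b →
      (Quotient.mk (cutSetoid α γ S) a) ≠ Quotient.mk _ b := fun h h' => h (Quotient.exact h')
  -- the value of `T` in each case is determined by that of `T 1 1`
  have fin1 : ∀ Θ : Matrix (Fin d) (Fin d) ℂ → Matrix (Fin d) (Fin d) ℂ → ℂ,
      (∀ A B, (d : ℂ) ^ 2 * T A B = (d : ℂ) ^ Nat.card (Quotient (cutSetoid α γ S)) * Θ A B) → ∀ x : ℂ, x ≠ 0 → Θ 1 1 = x →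
      T A B = (d : ℂ) ^ numComponents α γ ∅ * (Θ A B / x) := by
    intro Θ hΘ x hx hx1
    have e1 := hΘ 1 1
    rw [h1, hx1] at e1
    have e2 := hΘ A B
    have hd2 : (d : ℂ) ^ 2 ≠ 0 := pow_ne_zero _ hd'
    rw [← mul_right_inj' hd2, e2, ← mul_assoc, e1]
    field_simp
  have htcases : t = γ p ∨ t = q ∨ t = γ q := by
    rcases htS with h | h | h | h
    · exact absurd h htp
    · exact Or.inl h
    · exact Or.inr (Or.inl h)
    · exact Or.inr (Or.inr h)
  rcases htcases with rfl | rfl | rfl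
  · have hpq : ¬ cutSetoid α γ S p q := fun h => by
      rcases hpu q hqS h with h | h
      · exact hqp h
      · exact hqp' h
    obtain ⟨t', htS', htq, hqt, -, -⟩ := exists_partner hα hγ hα' hγ' hS hqS
    obtain rfl : t' = γ q := by
      rcases htS' with rfl | rfl | rfl | rfl
      · exact absurd ((cutSetoid α γ S).symm hqt) hpq
      · exact absurd ((cutSetoid α γ S).trans hpt ((cutSetoid α γ S).symm hqt)) hpq
      · exact absurd rfl htq
      · rfl
    -- Here each cut leaves its two sides joined, so cutting disconnects nothing and `q` cannot lie
    -- on the loop of `p`.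
    have hfull : ∀ r, cutSetoid α γ ∅ p r → cutSetoid α γ S p r := by
      intro r hr
      refine (cutSetoid_induction (P := fun r => cutSetoid α γ S p r) (fun r => ?_)
        (fun r _ => ?_) hr).1 ((cutSetoid α γ S).refl p)
      · exact ⟨fun h => (cutSetoid α γ S).trans h (cutSetoid_alpha S r),
          fun h => (cutSetoid α γ S).trans h ((cutSetoid α γ S).symm (cutSetoid_alpha S r))⟩
      · have h3 : cutSetoid α γ S r (γ r) := by
          by_cases hr : r ∈ S
          · rcases hr with rfl | rfl | rfl | rfl
            · exact hpt
            · rw [hγ]; exact (cutSetoid α γ S).symm hpt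
            · exact hqt
            · rw [hγ]; exact (cutSetoid α γ S).symm hqt
          · exact cutSetoid_gamma hr
        exact ⟨fun h => (cutSetoid α γ S).trans h h3,
          fun h => (cutSetoid α γ S).trans h ((cutSetoid α γ S).symm h3)⟩
    have hno : ¬ ((γ * α).SameCycle p q ∨ (γ * α).SameCycle p (α q)) := fun h =>
      hpq (hfull q ((cutSetoid_empty_iff hα hγ).2 h))
    rw [if_pos hno, if_neg (fun h => hno (Or.inl h)), if_neg (fun h => hno (Or.inr h)),
      zero_add, zero_add]
    refine fin1 (fun A B => A.trace * B.trace) (fun A B => ?_) _ (pow_ne_zero _ hd') ?_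
    · rw [hTdef, ← mk_eq hpt, ← mk_eq hqt]
      rw [card_sq_mul_sum_apply (mk_ne hpq) fun a b => A a a * B b b]
      simp only [Matrix.trace, Matrix.diag, Finset.sum_mul_sum]
    · simp [sq]
  · have hcyc' : (γ * α).SameCycle p (α t) := hcyc.trans hαq.symm
    have hn : ¬ (γ * α).SameCycle p t := fun h => hexcl h hcyc'
    rw [if_neg hn, if_pos hcyc', if_neg (by simp [hcyc']), zero_add, add_zero]
    have hpp' : ¬ cutSetoid α γ S p (γ p) := fun h => by
      rcases hpu _ hpS' h with h | h
      · exact hγ' p h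
      · exact hqp' h.symm
    obtain ⟨t', htS', htq, hqt, -, -⟩ := exists_partner hα hγ hα' hγ' hS hpS'
    obtain rfl : t' = γ t := by
      rcases htS' with rfl | rfl | rfl | rfl
      · exact absurd ((cutSetoid α γ S).symm hqt) hpp'
      · exact absurd rfl htq
      · exact absurd ((cutSetoid α γ S).trans hpt ((cutSetoid α γ S).symm hqt)) hpp'
      · rfl
    refine fin1 (fun A B => (A * Bᵀ).trace) (fun A B => ?_) _ hd' ?_
    · rw [hTdef, ← mk_eq hpt, ← mk_eq hqt]
      rw [card_sq_mul_sum_apply (mk_ne hpp') fun a b => A b a * B b a, Finset.sum_comm]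
      simp only [Matrix.trace, Matrix.diag, Matrix.mul_apply, Matrix.transpose_apply]
    · simp
  · rw [hγ] at hcyc
    have hn : ¬ (γ * α).SameCycle p (α q) := hexcl hcyc
    rw [if_neg hn, if_pos hcyc, if_neg (by simp [hcyc]), add_zero, add_zero]
    have hpq : ¬ cutSetoid α γ S p q := fun h => by
      rcases hpu _ hqS h with h | h
      · exact hqp h
      · exact hγ' q h.symm
    obtain ⟨t', htS', htq, hqt, -, -⟩ := exists_partner hα hγ hα' hγ' hS hqS
    obtain rfl : t' = γ p := by
      rcases htS' with rfl | rfl | rfl | rfl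
      · exact absurd ((cutSetoid α γ S).symm hqt) hpq
      · rfl
      · exact absurd rfl htq
      · exact absurd ((cutSetoid α γ S).trans hpt ((cutSetoid α γ S).symm hqt)) hpq
    refine fin1 (fun A B => (A * B).trace) (fun A B => ?_) _ hd' ?_
    · rw [hTdef, ← mk_eq hpt, ← mk_eq hqt]
      rw [card_sq_mul_sum_apply (mk_ne hpq) fun a b => A b a * B a b, Finset.sum_comm]
      simp only [Matrix.trace, Matrix.diag, Matrix.mul_apply]
    · simp

end Colouring

/-! ### Discrete loops

A word of `n` links cuts every site into `n + 1` segments. -/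

section Gluing

/-- How a link glues the ends of the segments above and below it: an end at `z` is glued to an end
at `perm z`, on the same side if `bar z`, and on the other side otherwise. -/
structure Gluing (V : Type*) where
  perm : Equiv.Perm V
  bar : V → Bool
  perm_perm : ∀ z, perm (perm z) = z
  bar_perm : ∀ z, bar (perm z) = bar z
  perm_ne : ∀ z, bar z = true → perm z ≠ z

variable {V : Type*}

/-- The gluing in which every site is continued. -/
def Gluing.trivial (V : Type*) : Gluing V where
  perm := 1
  bar _ := false
  perm_perm _ := rfl
  bar_perm _ := rfl
  perm_ne _ h := absurd h (by simp)

/-- The configurations below and above the link agree along the gluing. -/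
def Gluing.Compat (L : Gluing V) {d : ℕ} (σ τ : V → Fin d) : Prop :=
  ∀ z, if L.bar z then σ z = σ (L.perm z) ∧ τ z = τ (L.perm z) else σ z = τ (L.perm z)

variable {n : ℕ}

/-- The ends of the segments: `(z, k, true)` is the lower end of the `k`-th segment at `z`, and
`(z, k, false)` its upper end. -/
abbrev End (V : Type*) (n : ℕ) := V × Fin (n + 1) × Bool

/-- The other end of a segment. -/
def flipEnd (V : Type*) (n : ℕ) : Equiv.Perm (End V n) :=
  Function.Involutive.toPerm (fun p => (p.1, p.2.1, !p.2.2)) fun p => by simp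

@[simp] theorem flipEnd_apply (z : V) (k : Fin (n + 1)) (b : Bool) :
    flipEnd V n (z, k, b) = (z, k, !b) := rfl

theorem flipEnd_flipEnd (p : End V n) : flipEnd V n (flipEnd V n p) = p := by
  obtain ⟨z, k, b⟩ := p; simp

theorem flipEnd_ne (p : End V n) : flipEnd V n p ≠ p := by
  obtain ⟨z, k, b⟩ := p; simp

/-- The end glued to a given end; the link `L k` sits above the `k`-th segments, and time is
periodic. -/
def glueFun (L : Fin (n + 1) → Gluing V) (p : End V n) : End V n :=
  if p.2.2 then
    (if (L (p.2.1 - 1)).bar p.1 then ((L (p.2.1 - 1)).perm p.1, p.2.1, true)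
      else ((L (p.2.1 - 1)).perm p.1, p.2.1 - 1, false))
  else
    (if (L p.2.1).bar p.1 then ((L p.2.1).perm p.1, p.2.1, false)
      else ((L p.2.1).perm p.1, p.2.1 + 1, true))

theorem glueFun_involutive (L : Fin (n + 1) → Gluing V) : Function.Involutive (glueFun L) := by
  rintro ⟨z, k, b⟩
  cases b
  · by_cases h : (L k).bar z
    · simp [glueFun, h, Gluing.bar_perm, Gluing.perm_perm]
    · simp [glueFun, h, Gluing.bar_perm, Gluing.perm_perm]
  · by_cases h : (L (k - 1)).bar z
    · simp [glueFun, h, Gluing.bar_perm, Gluing.perm_perm]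
    · simp [glueFun, h, Gluing.bar_perm, Gluing.perm_perm]

/-- The gluing of the ends, as a permutation. -/
def glue (L : Fin (n + 1) → Gluing V) : Equiv.Perm (End V n) :=
  (glueFun_involutive L).toPerm

theorem glue_glue (L : Fin (n + 1) → Gluing V) (p : End V n) : glue L (glue L p) = p :=
  glueFun_involutive L p

theorem glue_false (L : Fin (n + 1) → Gluing V) (z : V) (k : Fin (n + 1)) :
    glue L (z, k, false) = if (L k).bar z then ((L k).perm z, k, false)
      else ((L k).perm z, k + 1, true) := by
  simp [glue, glueFun]

theorem glue_true (L : Fin (n + 1) → Gluing V) (z : V) (k : Fin (n + 1)) :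
    glue L (z, k, true) = if (L (k - 1)).bar z then ((L (k - 1)).perm z, k, true)
      else ((L (k - 1)).perm z, k - 1, false) := by
  simp [glue, glueFun]

theorem glue_ne (L : Fin (n + 1) → Gluing V) (p : End V n) : glue L p ≠ p := by
  obtain ⟨z, k, b⟩ := p
  cases b
  · rw [glue_false]
    split_ifs with h
    · simp [Gluing.perm_ne _ _ h]
    · simp
  · rw [glue_true]
    split_ifs with h
    · simp [Gluing.perm_ne _ _ h]
    · simp

/-- The gluings of a word, closed up periodically in time. -/
def closeUp (L : Fin n → Gluing V) : Fin (n + 1) → Gluing V :=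
  Fin.snoc (α := fun _ => Gluing V) L (Gluing.trivial V)

theorem closeUp_castSucc (L : Fin n → Gluing V) (k : Fin n) : closeUp L k.castSucc = L k := by
  simp [closeUp]

theorem closeUp_last (L : Fin n → Gluing V) : closeUp L (Fin.last n) = Gluing.trivial V := by
  simp [closeUp]

theorem zero_sub_one_eq_last : (0 : Fin (n + 1)) - 1 = Fin.last n := by
  rw [sub_eq_iff_eq_add, Fin.last_add_one]

theorem succ_sub_one_eq_castSucc (k : Fin n) : k.succ - 1 = k.castSucc := by
  rw [sub_eq_iff_eq_add, Fin.coeSucc_eq_succ]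

theorem glue_closeUp_zero (L : Fin n → Gluing V) (z : V) :
    glue (closeUp L) (z, 0, true) = (z, Fin.last n, false) := by
  rw [glue_true, zero_sub_one_eq_last, closeUp_last]
  simp [Gluing.trivial]

theorem glue_closeUp_last (L : Fin n → Gluing V) (z : V) :
    glue (closeUp L) (z, Fin.last n, false) = (z, 0, true) := by
  rw [← glue_closeUp_zero L, glue_glue]

/-- A colouring of the segments is the same as a sequence of configurations. -/
def colourEnds {d : ℕ} (s : Fin (n + 1) → V → Fin d) (p : End V n) : Fin d := s p.2.1 p.1

/-- The gluings at a link say that consecutive configurations are compatible; the periodic gluing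
says that the last configuration equals the first, except at the sites of `X`, where it is cut. -/
theorem isColouring_colourEnds_iff (L : Fin n → Gluing V) {d : ℕ} (s : Fin (n + 1) → V → Fin d)
    (X : Set V) {S : Set (End V n)}
    (hS : ∀ p, p ∈ S ↔ p.1 ∈ X ∧ (p.2 = (0, true) ∨ p.2 = (Fin.last n, false))) :
    IsColouring (flipEnd V n) (glue (closeUp L)) S (colourEnds s) ↔
      (∀ k : Fin n, (L k).Compat (s k.castSucc) (s k.succ)) ∧
        ∀ z ∉ X, s (Fin.last n) z = s 0 z := by
  constructor
  · rintro ⟨-, h⟩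
    constructor
    · intro k z
      have h1 := h (z, k.castSucc, false) (by simp [hS, Fin.castSucc_ne_last])
      rw [glue_false, closeUp_castSucc, Fin.coeSucc_eq_succ] at h1
      have h2 := h (z, k.succ, true) (by simp [hS, Fin.succ_ne_zero])
      rw [glue_true, succ_sub_one_eq_castSucc, closeUp_castSucc] at h2
      split_ifs with hb
      · rw [if_pos hb] at h1 h2
        exact ⟨h1.symm, h2.symm⟩
      · rw [if_neg hb] at h1
        exact h1.symm
    · intro z hz
      have h1 := h (z, Fin.last n, false) (by simp [hS, hz])
      rw [glue_closeUp_last] at h1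
      exact h1.symm
  · rintro ⟨h1, h2⟩
    refine ⟨fun p => rfl, ?_⟩
    rintro ⟨z, k, b⟩ hp
    cases b
    · cases k using Fin.lastCases with
      | last =>
        rw [glue_closeUp_last]
        exact (h2 z (fun hz => hp (by simp [hS, hz]))).symm
      | cast k =>
        rw [glue_false, closeUp_castSucc, Fin.coeSucc_eq_succ]
        have h3 := h1 k z
        split_ifs at h3 ⊢ with hb
        · exact h3.1.symm
        · exact h3.symm
    · cases k using Fin.cases with
      | zero =>
        rw [glue_closeUp_zero]
        exact h2 z (fun hz => hp (by simp [hS, hz]))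
      | succ k =>
        rw [glue_true, succ_sub_one_eq_castSucc, closeUp_castSucc]
        -- `Compat` relates `z` below the link to `perm z` above it, so seen from above it is used
        -- at `perm z`.
        have h3 := h1 k ((L k).perm z)
        rw [Gluing.bar_perm, Gluing.perm_perm] at h3
        split_ifs at h3 ⊢ with hb
        · exact h3.2
        · exact h3

open Classical in
theorem colouringSum_eq_sum_configurations [Fintype V] [DecidableEq V] (L : Fin n → Gluing V) {d : ℕ}
    (X : Set V) {S : Set (End V n)}
    (hS : ∀ p, p ∈ S ↔ p.1 ∈ X ∧ (p.2 = (0, true) ∨ p.2 = (Fin.last n, false)))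
    (F : (End V n → Fin d) → ℂ) :
    colouringSum (flipEnd V n) (glue (closeUp L)) S F =
      ∑ s : Fin (n + 1) → V → Fin d,
        (if ∀ z ∉ X, s (Fin.last n) z = s 0 z then F (colourEnds s) else 0) *
          ∏ k : Fin n, if (L k).Compat (s k.castSucc) (s k.succ) then 1 else 0 := by
  symm
  refine Fintype.sum_of_injective colourEnds ?_ _ _ ?_ ?_
  · intro s s' h
    funext k z
    exact congrFun h (z, k, true)
  · intro σ hσ
    rw [if_neg]
    rintro ⟨h, -⟩
    refine hσ ⟨fun k z => σ (z, k, true), ?_⟩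
    funext p
    obtain ⟨z, k, b⟩ := p
    cases b
    · exact h (z, k, false)
    · rfl
  · intro s
    have hiff := isColouring_colourEnds_iff L s X hS
    by_cases h1 : ∀ k : Fin n, (L k).Compat (s k.castSucc) (s k.succ)
    · rw [Finset.prod_congr rfl fun k _ => if_pos (h1 k), Finset.prod_const_one, mul_one]
      exact if_congr (by rw [hiff]; exact (and_iff_right h1).symm) rfl rfl
    · rw [if_neg (fun h => h1 (hiff.1 h).1)]
      obtain ⟨k, hk⟩ := not_forall.1 h1
      rw [Finset.prod_eq_zero (Finset.mem_univ k) (if_neg hk), mul_zero]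

end Gluing

/-- The trace of a product of matrices as a sum over closed paths. -/
theorem trace_mul_ofFn_prod {ι : Type*} [Fintype ι] [DecidableEq ι] {n : ℕ}
    (M : Matrix ι ι ℂ) (O : Fin n → Matrix ι ι ℂ) :
    (M * (List.ofFn O).prod).trace =
      ∑ s : Fin (n + 1) → ι, M (s (Fin.last n)) (s 0) * ∏ k, O k (s k.castSucc) (s k.succ) := by
  induction n generalizing M with
  | zero =>
    simp only [List.ofFn_zero, List.prod_nil, mul_one, Finset.univ_eq_empty, Finset.prod_empty]
    rw [← Equiv.sum_comp (Equiv.funUnique (Fin 1) ι).symm]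
    simp [Matrix.trace]
  | succ n ih =>
    -- By cyclicity of the trace the last factor moves to the front and is absorbed into `M`.
    rw [List.ofFn_succ', List.concat_eq_append, List.prod_append, List.prod_singleton,
      ← mul_assoc, Matrix.trace_mul_comm, ← mul_assoc, ih,
      ← Equiv.sum_comp (Fin.snocEquiv fun _ : Fin (n + 2) => ι), Fintype.sum_prod_type,
      Finset.sum_comm]
    refine Finset.sum_congr rfl fun s _ => ?_
    rw [Matrix.mul_apply, Finset.sum_mul]
    refine Finset.sum_congr rfl fun a _ => ?_
    rw [Fin.prod_univ_castSucc]
    have h0 : (Fin.snocEquiv fun _ : Fin (n + 2) => ι) (a, s) 0 = s 0 := by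
      rw [← Fin.castSucc_zero]
      simp [Fin.snocEquiv]
    have h1 : ∀ k : Fin (n + 1), (Fin.snocEquiv fun _ : Fin (n + 2) => ι) (a, s) k.castSucc = s k :=
      fun k => by simp [Fin.snocEquiv]
    have h2 : (Fin.snocEquiv fun _ : Fin (n + 2) => ι) (a, s) (Fin.last (n + 1)) = a := by
      simp [Fin.snocEquiv]
    simp only [Fin.succ_last, h0, h1, h2, Fin.succ_castSucc]
    ring

/-! ### Words of links: operators, permutations and traces -/

section Words

variable {V : Type*} [DecidableEq V] {G : SimpleGraph V}

/-- The exchange of the endpoints of an edge. -/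
def edgeSwap : Sym2 V → Equiv.Perm V :=
  Sym2.lift ⟨fun x y => Equiv.swap x y, Equiv.swap_comm⟩

/-- The gluing at a link. -/
def labelGluing (a : Edge G × LinkKind) : Gluing V where
  perm := edgeSwap a.1
  bar z := match a.2 with
    | .cross => false
    | .bar => decide (z ∈ (a.1 : Sym2 V))
  perm_perm z := by
    obtain ⟨⟨e, he⟩, k⟩ := a
    induction e using Sym2.ind with
    | _ x y => exact Equiv.swap_apply_self x y z
  bar_perm z := by
    obtain ⟨⟨e, he⟩, k⟩ := a
    cases k
    · rfl
    · induction e using Sym2.ind with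
      | _ x y =>
        simp only [edgeSwap, Sym2.lift_mk, Sym2.mem_iff, Equiv.swap_apply_def, decide_eq_decide]
        split_ifs <;> simp_all
  perm_ne z := by
    obtain ⟨⟨e, he⟩, k⟩ := a
    cases k
    · simp
    · induction e using Sym2.ind with
      | _ x y =>
        have hxy : x ≠ y := G.ne_of_adj he
        simp only [edgeSwap, Sym2.lift_mk, Sym2.mem_iff, decide_eq_true_eq]
        rintro (rfl | rfl)
        · rw [Equiv.swap_apply_left]; exact hxy.symm
        · rw [Equiv.swap_apply_right]; exact hxy

variable [Fintype V]

/-- The operator of a link. -/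
def labelOp (d : ℕ) (a : Edge G × LinkKind) : Op V d :=
  match a.2 with
  | .cross => Sym2.lift ⟨transpositionOp, transpositionOp_comm⟩ a.1
  | .bar => Sym2.lift ⟨doubleBarOp, doubleBarOp_comm⟩ a.1

-- This is what makes the trace of a word count colourings: no weights or signs occur.
open Classical in
theorem labelOp_apply {d : ℕ} (a : Edge G × LinkKind) (σ τ : V → Fin d) :
    labelOp d a σ τ = if (labelGluing a).Compat σ τ then 1 else 0 := by
  obtain ⟨⟨e, he⟩, k⟩ := a
  induction e using Sym2.ind with
  | _ x y =>
    cases k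
    · simp only [labelOp, Sym2.lift_mk, transpositionOp]
      refine if_congr ?_ rfl rfl
      simp only [Gluing.Compat, labelGluing, edgeSwap, Sym2.lift_mk, funext_iff,
        Function.comp_apply]
      simp
    · simp only [labelOp, Sym2.lift_mk, doubleBarOp]
      refine if_congr ?_ rfl rfl
      simp only [Gluing.Compat, labelGluing, edgeSwap, Sym2.lift_mk, Sym2.mem_iff,
        decide_eq_true_eq]
      constructor
      · rintro ⟨h1, h2, h3⟩ z
        split_ifs with hz
        · rcases hz with rfl | rfl
          · simp [h1, h2]
          · simp [h1, h2]
        · push Not at hz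
          rw [Equiv.swap_apply_of_ne_of_ne hz.1 hz.2]
          exact h3 z hz.1 hz.2
      · intro h
        refine ⟨?_, ?_, fun z hx hy => ?_⟩
        · simpa using (by simpa using h x : _ ∧ _).1
        · simpa using (by simpa using h x : _ ∧ _).2
        · have := h z
          rwa [if_neg (by simp [hx, hy]), Equiv.swap_apply_of_ne_of_ne hx hy] at this

theorem siteOp_mul_siteOp_apply {d : ℕ} {x y : V} (hxy : x ≠ y) (A B : Matrix (Fin d) (Fin d) ℂ)
    (σ τ : V → Fin d) :
    (siteOp x A * siteOp y B : Op V d) σ τ =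
      if ∀ z, z ≠ x → z ≠ y → σ z = τ z then A (σ x) (τ x) * B (σ y) (τ y) else 0 := by
  -- The only intermediate configuration that contributes has already changed at `x` and not yet at
  -- `y`.
  rw [Matrix.mul_apply, Finset.sum_eq_single (Function.update σ x (τ x))]
  · have h1 : ∀ z, z ≠ x → σ z = Function.update σ x (τ x) z := fun z hz => by
      rw [Function.update_of_ne hz]
    simp only [siteOp]
    rw [if_pos h1, Function.update_self, Function.update_of_ne hxy.symm, mul_ite, mul_zero]
    refine if_congr ⟨fun h z hx hy => ?_, fun h z hy => ?_⟩ rfl rfl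
    · rw [← h z hy, Function.update_of_ne hx]
    · by_cases hx : z = x
      · subst hx; simp
      · rw [Function.update_of_ne hx]; exact h z hx hy
  · intro ρ _ hρ
    simp only [siteOp]
    split_ifs with h1 h2
    · refine absurd ?_ hρ
      funext z
      by_cases hz : z = x
      · subst hz; simp [h2 z hxy]
      · rw [Function.update_of_ne hz]; exact (h1 z hz).symm
    all_goals simp
  · simp

variable {n : ℕ}

/-- The product of the operators of the links of a word. -/
def wordOp (d : ℕ) (l : Fin n → Edge G × LinkKind) : Op V d :=
  (List.ofFn fun k => labelOp d (l k)).prod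

/-- The permutation of the ends that follows the loops of a word. -/
def wordPerm (l : Fin n → Edge G × LinkKind) : Equiv.Perm (End V n) :=
  glue (closeUp fun k => labelGluing (l k)) * flipEnd V n

/-- The number of loops of a word. -/
noncomputable def wordLoops (l : Fin n → Edge G × LinkKind) : ℕ :=
  numComponents (flipEnd V n) (glue (closeUp fun k => labelGluing (l k))) ∅

/-- Bridge from traces to colourings: an operator acting only on the sites of `X` opens the lines of
these sites at time `0`, and its entries become the weight `F` of the colouring. -/
theorem trace_mul_wordOp {d : ℕ} (M : Op V d) (X : Set V) {S : Set (End V n)}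
    (hS : ∀ p, p ∈ S ↔ p.1 ∈ X ∧ (p.2 = (0, true) ∨ p.2 = (Fin.last n, false)))
    (F : (End V n → Fin d) → ℂ)
    (hM : ∀ s : Fin (n + 1) → V → Fin d, ((∀ z ∉ X, s (Fin.last n) z = s 0 z) →
      M (s (Fin.last n)) (s 0) = F (colourEnds s)) ∧
      (¬ (∀ z ∉ X, s (Fin.last n) z = s 0 z) → M (s (Fin.last n)) (s 0) = 0))
    (l : Fin n → Edge G × LinkKind) :
    (M * wordOp d l).trace =
      colouringSum (flipEnd V n) (glue (closeUp fun k => labelGluing (l k))) S F := by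
  classical
  rw [colouringSum_eq_sum_configurations _ X hS, wordOp, trace_mul_ofFn_prod]
  refine Finset.sum_congr rfl fun s _ => ?_
  simp only [labelOp_apply]
  congr 1
  split_ifs with h
  · exact (hM s).1 h
  · exact (hM s).2 h

theorem trace_wordOp (d : ℕ) (l : Fin n → Edge G × LinkKind) :
    (wordOp d l : Op V d).trace = (d : ℂ) ^ wordLoops l := by
  classical
  rw [wordLoops, ← colouringSum_empty_one, ← one_mul (wordOp d l)]
  refine trace_mul_wordOp 1 ∅ (by simp) _ (fun s => ?_) l
  simp [Matrix.one_apply, funext_iff]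

theorem trace_siteOp_mul_wordOp {d : ℕ} (hd : 1 ≤ d) (x : V) (A : Matrix (Fin d) (Fin d) ℂ)
    (l : Fin n → Edge G × LinkKind) :
    (siteOp x A * wordOp d l).trace = (d : ℂ) ^ wordLoops l * (A.trace / d) := by
  have hd' : (d : ℂ) ≠ 0 := Nat.cast_ne_zero.2 (by omega)
  have h := colouringSum_one_cut flipEnd_flipEnd
    (glue_glue (closeUp fun k => labelGluing (l k))) flipEnd_ne (glue_ne _) hd (x, 0, true) A
  rw [mul_div_assoc', wordLoops, ← h, mul_div_cancel_left₀ _ hd', glue_closeUp_zero]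
  refine trace_mul_wordOp _ {x} ?_ _ (fun s => ⟨fun h => ?_, fun h => ?_⟩) l
  · rintro ⟨z, k, b⟩
    simp only [Set.mem_insert_iff, Set.mem_singleton_iff, Prod.mk.injEq]
    tauto
  · exact if_pos h
  · exact if_neg h

-- The cuts are at `p = (x, 0, true)` and `q = (y, 0, true)`, whose glued ends are the tops of the
-- last segments; `α q = (y, 0, false)` is the site `y` traversed downwards.
open Classical in
theorem trace_siteOp_mul_siteOp_mul_wordOp {d : ℕ} (hd : 1 ≤ d) {x y : V} (hxy : x ≠ y)
    (A B : Matrix (Fin d) (Fin d) ℂ) (l : Fin n → Edge G × LinkKind) :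
    (siteOp x A * siteOp y B * wordOp d l).trace = (d : ℂ) ^ wordLoops l *
      ((if (wordPerm l).SameCycle (x, 0, true) (y, 0, true) then (A * B).trace / d else 0) +
        (if (wordPerm l).SameCycle (x, 0, true) (y, 0, false) then (A * Bᵀ).trace / d else 0) +
        (if ¬ ((wordPerm l).SameCycle (x, 0, true) (y, 0, true) ∨
            (wordPerm l).SameCycle (x, 0, true) (y, 0, false)) then
          A.trace * B.trace / (d : ℂ) ^ 2 else 0)) := by
  have h := colouringSum_two_cut flipEnd_flipEnd
    (glue_glue (closeUp fun k => labelGluing (l k))) flipEnd_ne (glue_ne _) hd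
    (p := (x, 0, true)) (q := (y, 0, true)) (by simp [hxy.symm])
    (by simp [glue_closeUp_zero]) A B
  refine Eq.trans ?_ (h.trans (by rw [wordLoops, wordPerm]; congr!))
  rw [glue_closeUp_zero, glue_closeUp_zero]
  refine trace_mul_wordOp _ {x, y} ?_ _ (fun s => ⟨fun h => ?_, fun h => ?_⟩) l
  · rintro ⟨z, k, b⟩
    simp only [Set.mem_insert_iff, Set.mem_singleton_iff, Prod.mk.injEq]
    tauto
  · rw [siteOp_mul_siteOp_apply hxy, if_pos]
    · rfl
    · intro z hx hy
      exact h z (by simp [hx, hy])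
  · rw [siteOp_mul_siteOp_apply hxy, if_neg]
    intro h'
    refine h fun z hz => ?_
    simp only [Set.mem_insert_iff, Set.mem_singleton_iff, not_or] at hz
    exact h' z hz.1 hz.2

omit [Fintype V] in
theorem wordPerm_not_both {x y : V} (l : Fin n → Edge G × LinkKind)
    (h : (wordPerm l).SameCycle (x, 0, true) (y, 0, true)) :
    ¬ (wordPerm l).SameCycle (x, 0, true) (y, 0, false) := fun h' =>
  not_sameCycle_alpha flipEnd_flipEnd (glue_glue (closeUp fun k => labelGluing (l k))) flipEnd_ne
    (glue_ne _) (y, 0, true) (h.symm.trans h')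

end Words

/-! ### Loops of a realization and loops of its word -/

section Bridge

variable {V : Type*} {G : SimpleGraph V} {n : ℕ}

/-- The set of links with given labels and times. -/
def linkSet (l : Fin n → Edge G × LinkKind) (t : Fin n → ℝ) : Set (Link G) :=
  range fun k => ((l k).1, (l k).2, t k)

theorem clear_linkSet_iff {l : Fin n → Edge G × LinkKind} {t : Fin n → ℝ} {x : V} {I : Set ℝ} :
    Clear (linkSet l t) x I ↔ ∀ k, x ∈ ((l k).1 : Sym2 V) → t k ∉ I := by
  simp [Clear, linkSet]

/-- The number of links before time `s`. -/
noncomputable def level (t : Fin n → ℝ) (s : ℝ) : Fin (n + 1) :=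
  ⟨(Finset.univ.filter fun i => t i < s).card,
    Nat.lt_succ_of_le ((Finset.card_le_univ _).trans_eq (Fintype.card_fin n))⟩

/-- The times increase, so the links before time `s` form an initial segment whose length is the
level. The inequality is strict: a link time belongs to the segment below it. -/
theorem val_lt_level_iff {t : Fin n → ℝ} (ht : StrictMono t) {s : ℝ} {i : Fin n} :
    (i : ℕ) < level t s ↔ t i < s := by
  obtain ⟨m, hmn, hm⟩ : ∃ m ≤ n, ∀ i : Fin n, (i : ℕ) < m ↔ t i < s := by
    classical
    have hex : ∃ m : ℕ, ∀ i : Fin n, m ≤ i → s ≤ t i := ⟨n, fun i hi => by omega⟩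
    refine ⟨Nat.find hex, Nat.find_min' hex fun i hi => by omega, fun i => ⟨fun hi => ?_, fun hi => ?_⟩⟩
    · have h := Nat.find_min hex hi
      push Not at h
      obtain ⟨j, hij, hj⟩ := h
      exact (ht.monotone (Fin.le_def.2 hij)).trans_lt hj
    · by_contra h
      exact absurd (Nat.find_spec hex i (not_lt.1 h)) (not_le.2 hi)
  have h1 : ((level t s : Fin (n + 1)) : ℕ) = m := by
    simp only [level]
    rw [Finset.filter_congr fun i _ => (hm i).symm, Fin.card_filter_val_lt]
    omega
  rw [h1, hm]

theorem level_eq {t : Fin n → ℝ} (ht : StrictMono t) {s : ℝ} {k : Fin (n + 1)}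
    (h1 : ∀ i : Fin n, (i : ℕ) < k → t i < s) (h2 : ∀ i : Fin n, (k : ℕ) ≤ i → s ≤ t i) :
    level t s = k := by
  have h : ∀ i : Fin n, (i : ℕ) < level t s ↔ (i : ℕ) < k := fun i => by
    rw [val_lt_level_iff ht]
    refine ⟨fun h => ?_, h1 i⟩
    by_contra h'
    exact absurd (h2 i (not_lt.1 h')) (not_le.2 h)
  apply Fin.ext
  rcases lt_trichotomy (level t s : ℕ) k with h3 | h3 | h3
  · have := (h ⟨level t s, by omega⟩).2 h3
    simp at this
  · exact h3
  · have := (h ⟨k, by omega⟩).1 h3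
    simp at this

theorem level_mono {t : Fin n → ℝ} (ht : StrictMono t) : Monotone (level t) := by
  intro s s' hs
  by_contra h
  push Not at h
  have h1 : (level t s' : ℕ) < level t s := h
  have h2 := (val_lt_level_iff ht (s := s) (i := ⟨level t s', by omega⟩)).1 h1
  have h3 := (val_lt_level_iff ht (s := s') (i := ⟨level t s', by omega⟩)).2 (h2.trans_le hs)
  simp at h3

theorem level_apply {t : Fin n → ℝ} (ht : StrictMono t) (k : Fin n) :
    level t (t k) = k.castSucc :=
  level_eq ht (fun _ hi => ht (Fin.lt_def.2 hi)) fun _ hi => ht.monotone (Fin.le_def.2 hi)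

theorem level_zero {t : Fin n → ℝ} (ht : StrictMono t) (h0 : ∀ k, 0 < t k) : level t 0 = 0 :=
  level_eq ht (fun i hi => by simp at hi) fun i _ => (h0 i).le

theorem level_end {t : Fin n → ℝ} (ht : StrictMono t) {β : ℝ} (hβ : ∀ k, t k < β) :
    level t β = Fin.last n :=
  level_eq ht (fun i _ => hβ i) fun i hi => by simp at hi; omega

variable [DecidableEq V] {l : Fin n → Edge G × LinkKind}

/-- The Boolean of an end doubles as a direction: from a lower end, `flipEnd` travels up the segment
and the gluing crosses the link above, so `true` means upwards. -/
theorem wordPerm_true (z : V) (k : Fin n) : wordPerm l (z, k.castSucc, true) =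
    if (labelGluing (l k)).bar z then ((labelGluing (l k)).perm z, k.castSucc, false)
      else ((labelGluing (l k)).perm z, k.succ, true) := by
  rw [wordPerm, Equiv.Perm.mul_apply, flipEnd_apply, Bool.not_true, glue_false, closeUp_castSucc,
    Fin.coeSucc_eq_succ]

theorem wordPerm_false (z : V) (k : Fin n) : wordPerm l (z, k.succ, false) =
    if (labelGluing (l k)).bar z then ((labelGluing (l k)).perm z, k.succ, true)
      else ((labelGluing (l k)).perm z, k.castSucc, false) := by
  rw [wordPerm, Equiv.Perm.mul_apply, flipEnd_apply, Bool.not_false, glue_true,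
    succ_sub_one_eq_castSucc, closeUp_castSucc]

theorem wordPerm_last (z : V) : wordPerm l (z, Fin.last n, true) = (z, 0, true) :=
  glue_closeUp_last _ z

theorem wordPerm_zero (z : V) : wordPerm l (z, 0, false) = (z, Fin.last n, false) :=
  glue_closeUp_zero _ z

theorem labelGluing_of_notMem {a : Edge G × LinkKind} {z : V} (hz : z ∉ (a.1 : Sym2 V)) :
    (labelGluing a).bar z = false ∧ (labelGluing a).perm z = z := by
  obtain ⟨⟨e, he⟩, k⟩ := a
  induction e using Sym2.ind with
  | _ x y =>
    simp only [Sym2.mem_iff, not_or] at hz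
    constructor
    · cases k <;> simp [labelGluing, hz.1, hz.2]
    · exact Equiv.swap_apply_of_ne_of_ne hz.1 hz.2

theorem labelGluing_perm_of_eq {a : Edge G × LinkKind} {x y : V} (ha : (a.1 : Sym2 V) = s(x, y)) :
    (labelGluing a).perm x = y := by
  simp [labelGluing, ha, edgeSwap]

theorem labelGluing_bar_of_cross {a : Edge G × LinkKind} (ha : a.2 = .cross) (x : V) :
    (labelGluing a).bar x = false := by
  simp [labelGluing, ha]

theorem labelGluing_bar_of_bar {a : Edge G × LinkKind} (ha : a.2 = .bar) {x y : V}
    (he : (a.1 : Sym2 V) = s(x, y)) : (labelGluing a).bar x = true := by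
  simp [labelGluing, ha, he]

/-- Reversing the direction at both places preserves the loop, so each elementary step needs
checking in one direction only. -/
theorem sameCycle_flip {z z' : V} {k k' : Fin (n + 1)} {c c' : Bool}
    (h : (wordPerm l).SameCycle (z, k, c) (z', k', c')) (b : Bool) :
    (wordPerm l).SameCycle (z, k, xor c b) (z', k', xor c' b) := by
  cases b
  · simpa using h
  · have h' : (wordPerm l).SameCycle _ _ := sameCycle_alpha flipEnd_flipEnd (glue_glue _) h
    rw [flipEnd_apply, flipEnd_apply] at h'
    simpa using h'

theorem sameCycle_of_apply_eq {p q : End V n} (h : wordPerm l p = q) :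
    (wordPerm l).SameCycle p q := ⟨1, by simpa using h⟩

theorem sameCycle_step_of_notMem {z : V} {k : Fin n} (hz : z ∉ ((l k).1 : Sym2 V)) (b : Bool) :
    (wordPerm l).SameCycle (z, k.castSucc, b) (z, k.succ, b) := by
  have h : (wordPerm l).SameCycle (z, k.castSucc, true) (z, k.succ, true) :=
    sameCycle_of_apply_eq (by
      rw [wordPerm_true, (labelGluing_of_notMem hz).1, (labelGluing_of_notMem hz).2]; simp)
  simpa using sameCycle_flip h (!b)

theorem sameCycle_cross {x y : V} {k : Fin n} (hk : (l k).2 = .cross)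
    (he : ((l k).1 : Sym2 V) = s(x, y)) (b : Bool) :
    (wordPerm l).SameCycle (x, k.castSucc, b) (y, k.succ, b) := by
  have h : (wordPerm l).SameCycle (x, k.castSucc, true) (y, k.succ, true) :=
    sameCycle_of_apply_eq (by
      rw [wordPerm_true, labelGluing_bar_of_cross hk, labelGluing_perm_of_eq he]; simp)
  simpa using sameCycle_flip h (!b)

theorem sameCycle_bar_below {x y : V} {k : Fin n} (hk : (l k).2 = .bar)
    (he : ((l k).1 : Sym2 V) = s(x, y)) (b : Bool) :
    (wordPerm l).SameCycle (x, k.castSucc, b) (y, k.castSucc, !b) := by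
  have h : (wordPerm l).SameCycle (x, k.castSucc, true) (y, k.castSucc, false) :=
    sameCycle_of_apply_eq (by
      rw [wordPerm_true, labelGluing_bar_of_bar hk he, labelGluing_perm_of_eq he]; simp)
  simpa using sameCycle_flip h (!b)

theorem sameCycle_bar_above {x y : V} {k : Fin n} (hk : (l k).2 = .bar)
    (he : ((l k).1 : Sym2 V) = s(x, y)) (b : Bool) :
    (wordPerm l).SameCycle (x, k.succ, b) (y, k.succ, !b) := by
  have h : (wordPerm l).SameCycle (x, k.succ, false) (y, k.succ, true) :=
    sameCycle_of_apply_eq (by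
      rw [wordPerm_false, labelGluing_bar_of_bar hk he, labelGluing_perm_of_eq he]; simp)
  simpa using sameCycle_flip h b

theorem sameCycle_zero_last (z : V) (b : Bool) :
    (wordPerm l).SameCycle (z, 0, b) (z, Fin.last n, b) := by
  have h : (wordPerm l).SameCycle (z, 0, false) (z, Fin.last n, false) :=
    sameCycle_of_apply_eq (wordPerm_zero z)
  simpa using sameCycle_flip h b

theorem sameCycle_vertical {x : V} (b : Bool) {i j : Fin (n + 1)} (hij : i ≤ j)
    (h : ∀ k : Fin n, (i : ℕ) ≤ k → (k : ℕ) < j → x ∉ ((l k).1 : Sym2 V)) :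
    (wordPerm l).SameCycle (x, i, b) (x, j, b) := by
  induction j using Fin.induction with
  | zero =>
    obtain rfl : i = 0 := by simpa using hij
    exact Equiv.Perm.SameCycle.refl _ _
  | succ k ih =>
    rcases hij.eq_or_lt with rfl | hlt
    · exact Equiv.Perm.SameCycle.refl _ _
    · have hik : i ≤ k.castSucc := Fin.le_castSucc_iff.2 hlt
      refine (ih hik fun k' h1 h2 => h k' h1 ?_).trans (sameCycle_step_of_notMem (h k ?_ ?_) b)
      · simp at h2 ⊢; omega
      · simpa [Fin.le_def] using hik
      · simp

variable {t : Fin n → ℝ} (ht : StrictMono t) {β : ℝ} (h0 : ∀ k, 0 < t k) (hβt : ∀ k, t k < β)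
include ht h0 hβt

/-- Each move is a vertical run to the segment adjacent to a link (`below`, `above`), possibly
followed by the crossing of that link and another run. A link lying between the levels of a run
occurs in the clear interval, so it does not touch the site. -/
theorem sameCycle_of_move {p q : V × ℝ × Bool} (h : Move β (linkSet l t) p q) :
    (wordPerm l).SameCycle (p.1, level t p.2.1, p.2.2) (q.1, level t q.2.1, q.2.2) := by
  have below : ∀ (x : V) (s : ℝ) (b : Bool) (k : Fin n), s < t k →
      Clear (linkSet l t) x (Ico s (t k)) →
      (wordPerm l).SameCycle (x, level t s, b) (x, k.castSucc, b) := by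
    intro x s b k hsk hx
    refine sameCycle_vertical b ?_ fun j h1 h2 hj => ?_
    · rw [← level_apply ht]; exact level_mono ht hsk.le
    · refine clear_linkSet_iff.1 hx j hj ⟨?_, ht (Fin.lt_def.2 h2)⟩
      by_contra h3
      exact absurd ((val_lt_level_iff ht).2 (not_le.1 h3)) (not_lt.2 h1)
  have above : ∀ (x : V) (s : ℝ) (b : Bool) (k : Fin n), t k < s →
      Clear (linkSet l t) x (Ioc (t k) s) →
      (wordPerm l).SameCycle (x, k.succ, b) (x, level t s, b) := by
    intro x s b k hsk hx
    refine sameCycle_vertical b ?_ fun j h1 h2 hj => ?_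
    · rw [Fin.le_def, Fin.val_succ]
      exact Nat.succ_le_of_lt <| (val_lt_level_iff ht).2 hsk
    · exact clear_linkSet_iff.1 hx j hj ⟨ht (Fin.lt_def.2 (by simp at h1; omega)),
        ((val_lt_level_iff ht).1 h2).le⟩
  cases h with
  | vertical x s s' b hs hst hs' hx =>
    refine sameCycle_vertical b (level_mono ht hst) fun k h1 h2 hk => ?_
    refine clear_linkSet_iff.1 hx k hk ⟨?_, ((val_lt_level_iff ht).1 h2).le⟩
    by_contra h3
    exact absurd ((val_lt_level_iff ht).2 (not_le.1 h3)) (not_lt.2 h1)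
  | periodic x b =>
    simp only [level_zero ht h0, level_end ht hβt]
    exact sameCycle_zero_last x b
  | cross e r hl x y he s s' b hs hsr hrt hs' hx hy =>
    obtain ⟨k, hk⟩ := hl
    simp only [Prod.mk.injEq] at hk
    obtain ⟨rfl, hk2, rfl⟩ := hk
    exact ((below x s b k hsr hx).trans (sameCycle_cross hk2 he b)).trans (above y s' b k hrt hy)
  | barBelow e r hl x y he s s' b hs hsr hs' hsr' hx hy =>
    obtain ⟨k, hk⟩ := hl
    simp only [Prod.mk.injEq] at hk
    obtain ⟨rfl, hk2, rfl⟩ := hk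
    exact ((below x s b k hsr hx).trans (sameCycle_bar_below hk2 he b)).trans
      (below y s' _ k hsr' hy).symm
  | barAbove e r hl x y he s s' b hs hsr hs' hsr' hx hy =>
    obtain ⟨k, hk⟩ := hl
    simp only [Prod.mk.injEq] at hk
    obtain ⟨rfl, hk2, rfl⟩ := hk
    exact ((above x s b k hs hx).symm.trans (sameCycle_bar_above hk2 he b)).trans
      (above y s' _ k hs' hy)

theorem sameCycle_of_connected {p q : V × ℝ × Bool} (h : Connected β (linkSet l t) p q) :
    (wordPerm l).SameCycle (p.1, level t p.2.1, p.2.2) (q.1, level t q.2.1, q.2.2) := by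
  induction (show Relation.EqvGen _ p q from h) with
  | rel a b hab => exact sameCycle_of_move ht h0 hβt hab
  | refl a => exact Equiv.Perm.SameCycle.refl _ _
  | symm a b _ ih => exact (ih ‹_›).symm
  | trans a b c _ _ ih1 ih2 => exact (ih1 ‹_›).trans (ih2 ‹_›)

omit [DecidableEq V] in
theorem exists_time_of_level (hβ : 0 ≤ β) (k : Fin (n + 1)) :
    ∃ m ∈ Icc 0 β, (∀ i : Fin n, (i : ℕ) < k → t i < m) ∧ ∀ i : Fin n, (k : ℕ) ≤ i → m < t i := by
  classical
  -- If `β = 0` there can be no link, and time `0` serves.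
  rcases hβ.eq_or_lt with rfl | hβ'
  · exact ⟨0, ⟨le_rfl, le_rfl⟩, fun i => absurd (hβt i) (h0 i).not_gt,
      fun i => absurd (hβt i) (h0 i).not_gt⟩
  · obtain ⟨m, hm1, hm2⟩ := Order.exists_between_finsets
      (lo := insert 0 ((Finset.univ.filter fun i : Fin n => (i : ℕ) < k).image t))
      (hi := insert β ((Finset.univ.filter fun i : Fin n => (k : ℕ) ≤ i).image t)) (by
        intro a ha b hb
        simp only [Finset.mem_insert, Finset.mem_image, Finset.mem_filter, Finset.mem_univ,
          true_and] at ha hb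
        rcases ha with rfl | ⟨i, hi, rfl⟩ <;> rcases hb with rfl | ⟨j, hj, rfl⟩
        · exact hβ'
        · exact h0 j
        · exact hβt i
        · exact ht (Fin.lt_def.2 (by omega)))
    refine ⟨m, ⟨(hm1 0 (by simp)).le, (hm2 β (by simp)).le⟩, fun i hi => hm1 _ ?_,
      fun i hi => hm2 _ ?_⟩
    · simp only [Finset.mem_insert, Finset.mem_image, Finset.mem_filter, Finset.mem_univ, true_and]
      exact Or.inr ⟨i, hi, rfl⟩
    · simp only [Finset.mem_insert, Finset.mem_image, Finset.mem_filter, Finset.mem_univ, true_and]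
      exact Or.inr ⟨i, hi, rfl⟩

/-- There are representative times of the segments, such that following the discrete loops amounts
to moving between the representative points. -/
theorem exists_representatives (hβ : 0 ≤ β) : ∃ m : Fin (n + 1) → ℝ,
    (∀ (x : V) (k : Fin (n + 1)), (x, m k) ∈ regularPoints β (linkSet l t)) ∧
    (∀ k, level t (m k) = k) ∧
    (∀ p : V × ℝ, p ∈ regularPoints β (linkSet l t) → ∀ b,
      Connected β (linkSet l t) (p.1, p.2, b) (p.1, m (level t p.2), b)) ∧
    ∀ p q : End V n, (wordPerm l).SameCycle p q →
      Connected β (linkSet l t) (p.1, m p.2.1, p.2.2) (q.1, m q.2.1, q.2.2) := by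
  choose m hm hlt hgt using exists_time_of_level ht h0 hβt hβ
  -- Only link `k` occurs between the representative times of segments `k` and `k + 1`.
  have hclear : ∀ (x : V) (k : Fin n) {I : Set ℝ}, I ⊆ Icc (m k.castSucc) (m k.succ) →
      (x ∈ ((l k).1 : Sym2 V) → t k ∉ I) → Clear (linkSet l t) x I := by
    intro x k I hI hk
    rw [clear_linkSet_iff]
    intro j hj hjI
    have h1 := hI hjI
    have h2 : ¬ (j : ℕ) < k := fun h => absurd (hlt k.castSucc j (by simpa using h)) (not_lt.2 h1.1)
    have h3 : ¬ (k : ℕ) + 1 ≤ j := fun h => absurd (hgt k.succ j (by simpa using h)) (not_lt.2 h1.2)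
    obtain rfl : j = k := Fin.ext (by omega)
    exact hk hj hjI
  have hlk : ∀ k : Fin n, m k.castSucc < t k := fun k => hgt _ _ (by simp)
  have hkl : ∀ k : Fin n, t k < m k.succ := fun k => hlt _ _ (by simp)
  have hreg : ∀ (x : V) (k : Fin (n + 1)), Clear (linkSet l t) x {m k} := by
    intro x k
    rw [clear_linkSet_iff]
    intro j _ hj
    rw [mem_singleton_iff] at hj
    rcases lt_or_ge (j : ℕ) k with h | h
    · exact absurd (hlt k j h) hj.not_lt
    · exact absurd (hgt k j h) hj.not_gt
  -- The path goes down from `m 0` to time `0`, is identified with time `β`, and goes down to `m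
  -- (Fin.last n)`.
  have hlast : ∀ (x : V) (b : Bool),
      Connected β (linkSet l t) (x, m 0, b) (x, m (Fin.last n), b) := by
    intro x b
    refine Relation.EqvGen.trans _ (x, 0, b) _ (Relation.EqvGen.symm _ _ (Relation.EqvGen.rel _ _
      (Move.vertical x 0 (m 0) b le_rfl (hm 0).1 (hm 0).2 ?_))) ?_
    · rw [clear_linkSet_iff]
      exact fun j _ hj => absurd (hgt 0 j (by simp)) (not_lt.2 hj.2)
    refine Relation.EqvGen.trans _ (x, β, b) _ (Relation.EqvGen.rel _ _ (Move.periodic x b))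
      (Relation.EqvGen.symm _ _ (Relation.EqvGen.rel _ _
        (Move.vertical x _ _ b (hm _).1 (hm _).2 le_rfl ?_)))
    rw [clear_linkSet_iff]
    exact fun j _ hj => absurd (hlt (Fin.last n) j (by simp)) (not_lt.2 hj.1)
  have hvert : ∀ (x : V) (b : Bool) (k : Fin n), x ∉ ((l k).1 : Sym2 V) →
      Connected β (linkSet l t) (x, m k.castSucc, b) (x, m k.succ, b) := by
    intro x b k hx
    exact Relation.EqvGen.rel _ _ (Move.vertical x _ _ b (hm _).1 ((hlk k).trans (hkl k)).le (hm _).2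
      (hclear x k Subset.rfl fun h => absurd h hx))
  have hmem : ∀ k : Fin n, ((l k).1, (l k).2, t k) ∈ linkSet l t := fun k => ⟨k, rfl⟩
  have hIco : ∀ (x : V) (k : Fin n), Clear (linkSet l t) x (Ico (m k.castSucc) (t k)) := fun x k =>
    hclear x k (fun s hs => ⟨hs.1, (hs.2.trans (hkl k)).le⟩) fun _ h => lt_irrefl _ h.2
  have hIoc : ∀ (x : V) (k : Fin n), Clear (linkSet l t) x (Ioc (t k) (m k.succ)) := fun x k =>
    hclear x k (fun s hs => ⟨((hlk k).trans hs.1).le, hs.2⟩) fun _ h => lt_irrefl _ h.1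
  have hcross : ∀ (x y : V) (b : Bool) (k : Fin n), (l k).2 = .cross →
      ((l k).1 : Sym2 V) = s(x, y) →
      Connected β (linkSet l t) (x, m k.castSucc, b) (y, m k.succ, b) := by
    intro x y b k hk he
    exact Relation.EqvGen.rel _ _ (Move.cross (l k).1 (t k) (hk ▸ hmem k) x y he _ _ b (hm _).1
      (hlk k) (hkl k) (hm _).2 (hIco x k) (hIoc y k))
  have hstep : ∀ p : End V n, Connected β (linkSet l t) (p.1, m p.2.1, p.2.2)
      ((wordPerm l p).1, m (wordPerm l p).2.1, (wordPerm l p).2.2) := by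
    rintro ⟨z, k, b⟩
    cases b
    · cases k using Fin.cases with
      | zero => rw [wordPerm_zero]; exact hlast z false
      | succ k =>
        rw [wordPerm_false]
        by_cases hz : z ∈ ((l k).1 : Sym2 V)
        · obtain ⟨y, hy⟩ := Sym2.mem_iff_exists.1 hz
          rcases hk : (l k).2 with _ | _
          · rw [labelGluing_bar_of_cross hk, labelGluing_perm_of_eq hy]
            exact Relation.EqvGen.symm _ _ (hcross y z false k hk (by rw [hy, Sym2.eq_swap]))
          · rw [labelGluing_bar_of_bar hk hy, labelGluing_perm_of_eq hy]
            exact Relation.EqvGen.rel _ _ (Move.barAbove (l k).1 (t k) (hk ▸ hmem k) z y hy _ _ false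
              (hkl k) (hm _).2 (hkl k) (hm _).2 (hIoc z k) (hIoc y k))
        · rw [(labelGluing_of_notMem hz).1, (labelGluing_of_notMem hz).2]
          exact Relation.EqvGen.symm _ _ (hvert z false k hz)
    · cases k using Fin.lastCases with
      | last => rw [wordPerm_last]; exact Relation.EqvGen.symm _ _ (hlast z true)
      | cast k =>
        rw [wordPerm_true]
        by_cases hz : z ∈ ((l k).1 : Sym2 V)
        · obtain ⟨y, hy⟩ := Sym2.mem_iff_exists.1 hz
          rcases hk : (l k).2 with _ | _
          · rw [labelGluing_bar_of_cross hk, labelGluing_perm_of_eq hy]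
            exact hcross z y true k hk hy
          · rw [labelGluing_bar_of_bar hk hy, labelGluing_perm_of_eq hy]
            exact Relation.EqvGen.rel _ _ (Move.barBelow (l k).1 (t k) (hk ▸ hmem k) z y hy _ _ true
              (hm _).1 (hlk k) (hm _).1 (hlk k) (hIco z k) (hIco y k))
        · rw [(labelGluing_of_notMem hz).1, (labelGluing_of_notMem hz).2]
          exact hvert z true k hz
  refine ⟨m, fun x k => ⟨hm k, hreg x k⟩,
    fun k => level_eq ht (hlt k) fun i hi => (hgt k i hi).le, ?_, ?_⟩
  · rintro ⟨x, s⟩ ⟨hs, hxs⟩ b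
    rw [clear_linkSet_iff] at hxs
    simp only at hs hxs ⊢
    rcases le_total s (m (level t s)) with h | h
    · refine Relation.EqvGen.rel _ _ (Move.vertical x _ _ b hs.1 h (hm _).2 ?_)
      rw [clear_linkSet_iff]
      intro j _ hj
      rcases lt_or_ge (j : ℕ) (level t s) with h1 | h1
      · exact absurd ((val_lt_level_iff ht).1 h1) (not_lt.2 hj.1)
      · exact absurd (hgt _ j h1) (not_lt.2 hj.2)
    · refine Relation.EqvGen.symm _ _
        (Relation.EqvGen.rel _ _ (Move.vertical x _ _ b (hm _).1 h hs.2 ?_))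
      rw [clear_linkSet_iff]
      intro j hj1 hj
      rcases lt_or_ge (j : ℕ) (level t s) with h1 | h1
      · exact absurd (hlt _ j h1) (not_lt.2 hj.1)
      · refine hxs j hj1 (le_antisymm hj.2 ?_)
        by_contra h2
        exact absurd ((val_lt_level_iff ht).2 (not_le.1 h2)) (not_lt.2 h1)
  · intro p q h
    exact rel_of_sameCycle (r := (Relation.EqvGen.setoid (Move β (linkSet l t))).comap
      fun p : End V n => (p.1, m p.2.1, p.2.2)) hstep h

theorem connected_iff (hβ : 0 ≤ β) {p q : V × ℝ} (hp : p ∈ regularPoints β (linkSet l t))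
    (hq : q ∈ regularPoints β (linkSet l t)) (b c : Bool) :
    Connected β (linkSet l t) (p.1, p.2, b) (q.1, q.2, c) ↔
      (wordPerm l).SameCycle (p.1, level t p.2, b) (q.1, level t q.2, c) := by
  refine ⟨sameCycle_of_connected ht h0 hβt, fun h => ?_⟩
  obtain ⟨m, -, -, h1, h2⟩ := exists_representatives (l := l) ht h0 hβt hβ
  exact Relation.EqvGen.trans _ _ _ (h1 p hp b) (Relation.EqvGen.trans _ _ _ (h2 _ _ h)
    (Relation.EqvGen.symm _ _ (h1 q hq c)))

omit [DecidableEq V] ht hβt in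
theorem zero_mem_regularPoints (hβ : 0 ≤ β) (x : V) :
    (x, (0 : ℝ)) ∈ regularPoints β (linkSet l t) := by
  refine ⟨⟨le_rfl, hβ⟩, clear_linkSet_iff.2 fun k _ hk => ?_⟩
  exact absurd hk (h0 k).ne'

theorem connected_zero_iff (hβ : 0 ≤ β) (x y : V) (b c : Bool) :
    Connected β (linkSet l t) (x, 0, b) (y, 0, c) ↔
      (wordPerm l).SameCycle (x, 0, b) (y, 0, c) := by
  have h := connected_iff ht h0 hβt hβ (l := l) (zero_mem_regularPoints h0 hβ x)
    (zero_mem_regularPoints h0 hβ y) b c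
  simpa only [level_zero ht h0] using h

/-- A loop as a point set forgets its orientation, hence corresponds to a component of `cutSetoid`
without cuts, not to an orbit of `wordPerm`. Distinct components give distinct sets because each
segment contains its representative point. -/
theorem ncard_loops (hβ : 0 ≤ β) : (loops β (linkSet l t)).ncard = wordLoops l := by
  obtain ⟨m, hm, hlm, -, -⟩ := exists_representatives (l := l) ht h0 hβt hβ
  set r := cutSetoid (flipEnd V n) (glue (closeUp fun k => labelGluing (l k))) ∅ with hr
  have hr_iff : ∀ {p q : End V n}, r p q ↔ (wordPerm l).SameCycle p q ∨
      (wordPerm l).SameCycle p (flipEnd V n q) := cutSetoid_empty_iff flipEnd_flipEnd (glue_glue _)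
  let Φ : Quotient r → Set (V × ℝ) := Quotient.lift
    (fun p => {q | q ∈ regularPoints β (linkSet l t) ∧ r p (q.1, level t q.2, true)})
    (fun a b hab => by
      ext q
      exact and_congr_right fun _ => ⟨fun h => r.trans (r.symm hab) h, fun h => r.trans hab h⟩)
  have hΦ : ∀ p ∈ regularPoints β (linkSet l t),
      loopThrough β (linkSet l t) p = Φ (Quotient.mk r (p.1, level t p.2, true)) := by
    intro p hp
    ext q
    refine and_congr_right fun hq => ?_
    rw [hr_iff]
    constructor
    · rintro ⟨b, hb⟩
      rw [connected_iff ht h0 hβt hβ hp hq] at hb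
      cases b
      · exact Or.inr hb
      · exact Or.inl hb
    · rintro (h | h)
      · exact ⟨true, (connected_iff ht h0 hβt hβ hp hq _ _).2 h⟩
      · exact ⟨false, (connected_iff ht h0 hβt hβ hp hq _ _).2 h⟩
  have htrue : ∀ p : End V n, r p (p.1, p.2.1, true) := by
    rintro ⟨z, k, b⟩
    cases b
    · exact cutSetoid_alpha _ _
    · exact r.refl _
  have hrange : loops β (linkSet l t) = range Φ := by
    ext A
    constructor
    · rintro ⟨p, hp, rfl⟩
      exact ⟨_, (hΦ p hp).symm⟩
    · rintro ⟨a, rfl⟩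
      induction a using Quotient.inductionOn with
      | h p =>
        refine ⟨(p.1, m p.2.1), hm _ _, ?_⟩
        rw [hΦ _ (hm _ _), hlm]
        exact congrArg Φ (Quotient.sound (r.symm (htrue p)))
  have hinj : Function.Injective Φ := by
    intro a b
    induction a using Quotient.inductionOn with
    | h p =>
      induction b using Quotient.inductionOn with
      | h q =>
        intro hpq
        have h1 : (p.1, m p.2.1) ∈ Φ (Quotient.mk r p) := ⟨hm _ _, by
          simp only [hlm]; exact htrue p⟩
        rw [hpq] at h1
        have h2 : r q (p.1, level t (m p.2.1), true) := h1.2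
        rw [hlm] at h2
        exact Quotient.sound (r.trans (htrue p) (r.symm h2))
  rw [hrange, ← image_univ, ncard_image_of_injective _ hinj, ncard_univ]
  rfl

end Bridge

/-! ### The Poisson point measure of words -/

section Poisson

theorem measurableEmbedding_sigmaMk {ι : Type*} {X : ι → Type*} [∀ i, MeasurableSpace (X i)]
    (i : ι) : MeasurableEmbedding (Sigma.mk i : X i → Σ i, X i) where
  injective := sigma_mk_injective
  measurable := fun s hs => (MeasurableSpace.measurableSet_iInf.1 hs) i
  measurableSet_image' := by
    intro s hs
    refine MeasurableSpace.measurableSet_iInf.2 fun j => ?_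
    change MeasurableSet (Sigma.mk j ⁻¹' (Sigma.mk i '' s))
    by_cases hij : i = j
    · subst hij
      rwa [preimage_image_eq _ sigma_mk_injective]
    · convert MeasurableSet.empty
      ext x
      simp only [mem_preimage, mem_image, Sigma.mk.injEq, mem_empty_iff_false, iff_false]
      rintro ⟨y, -, h, -⟩
      exact hij h

theorem measurableSet_sigma {ι : Type*} {X : ι → Type*} [∀ i, MeasurableSpace (X i)]
    {s : Set (Σ i, X i)} (hs : ∀ i, MeasurableSet (Sigma.mk i ⁻¹' s)) : MeasurableSet s :=
  MeasurableSpace.measurableSet_iInf.2 hs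

/-- No measurability of `f` is needed, because each inclusion of the `n`-point families is a
measurable embedding. -/
theorem lintegral_poissonLaw {X : Type*} [MeasurableSpace X] (μ : Measure X)
    (f : (Σ n : ℕ, (Fin n → X)) → ℝ≥0∞) :
    ∫⁻ ω, f ω ∂(poissonLaw μ) =
      ∑' n : ℕ, (ENNReal.ofReal (Real.exp (-(μ univ).toReal)) / (n ! : ℝ≥0∞)) *
        ∫⁻ ω, f ⟨n, ω⟩ ∂(Measure.pi fun _ : Fin n => μ) := by
  rw [poissonLaw, lintegral_sum_measure]
  refine tsum_congr fun n => ?_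
  rw [lintegral_smul_measure, (measurableEmbedding_sigmaMk n).lintegral_map, smul_eq_mul]

theorem ae_poissonLaw {X : Type*} [MeasurableSpace X] (μ : Measure X)
    {P : (Σ n : ℕ, (Fin n → X)) → Prop}
    (h : ∀ n, ∀ᵐ ω ∂(Measure.pi fun _ : Fin n => μ), P ⟨n, ω⟩) : ∀ᵐ ω ∂(poissonLaw μ), P ω := by
  rw [poissonLaw, Measure.ae_sum_iff]
  exact fun n => Measure.ae_smul_measure ((measurableEmbedding_sigmaMk n).ae_map_iff.2 (h n)) _

instance (n : ℕ) : MeasurableSpace (Equiv.Perm (Fin n)) := ⊤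

/-- Finitely many comparisons between coordinates, ties being broken by index, characterize the
sorting permutation. -/
theorem measurable_sort (n : ℕ) : Measurable fun t : Fin n → ℝ => Tuple.sort t := by
  refine measurable_to_countable' fun σ => ?_
  have h : (fun t : Fin n → ℝ => Tuple.sort t) ⁻¹' {σ} =
      ⋂ i, ⋂ j, {t : Fin n → ℝ | (i ≤ j → t (σ i) ≤ t (σ j)) ∧
        (i < j → t (σ i) = t (σ j) → σ i < σ j)} := by
    ext t
    simp only [mem_preimage, mem_singleton_iff, mem_iInter, mem_ofPred_eq]
    rw [eq_comm, Tuple.eq_sort_iff]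
    exact ⟨fun h i j => ⟨fun hij => h.1 hij, h.2 i j⟩,
      fun h => ⟨fun i j hij => (h i j).1 hij, fun i j => (h i j).2⟩⟩
  rw [h]
  refine MeasurableSet.iInter fun i => MeasurableSet.iInter fun j => ?_
  have hi : Measurable fun t : Fin n → ℝ => t (σ i) := measurable_pi_apply _
  have hj : Measurable fun t : Fin n → ℝ => t (σ j) := measurable_pi_apply _
  have h1 : MeasurableSet {t : Fin n → ℝ | i ≤ j → t (σ i) ≤ t (σ j)} := by
    by_cases hij : i ≤ j
    · simpa only [hij, forall_const] using measurableSet_le hi hj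
    · simp only [hij, false_imp_iff]
      exact MeasurableSet.univ
  have h2 : MeasurableSet {t : Fin n → ℝ | i < j → t (σ i) = t (σ j) → σ i < σ j} := by
    by_cases hij : i < j
    · by_cases hs : σ i < σ j
      · simp only [hs, imp_true_iff]
        exact MeasurableSet.univ
      · simp only [hij, hs, forall_const, imp_false]
        exact (measurableSet_eq_fun hi hj).compl
    · simp only [hij, false_imp_iff]
      exact MeasurableSet.univ
  exact h1.inter h2

theorem volume_eq_coord {n : ℕ} {i j : Fin n} (hij : i ≠ j) :
    volume {t : Fin n → ℝ | t i = t j} = 0 := by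
  let S : Submodule ℝ (Fin n → ℝ) :=
    LinearMap.ker ((LinearMap.proj i : (Fin n → ℝ) →ₗ[ℝ] ℝ) - LinearMap.proj j)
  have hS : (S : Set (Fin n → ℝ)) = {t | t i = t j} := by
    ext t; simp [S, sub_eq_zero]
  rw [← hS]
  -- A proper subspace is null; the `i`-th basis vector is not in it.
  refine Measure.addHaar_submodule _ S fun h => ?_
  have h1 : (Pi.single i 1 : Fin n → ℝ) ∈ S := h ▸ Submodule.mem_top
  have h2 : (Pi.single i 1 : Fin n → ℝ) ∈ (S : Set (Fin n → ℝ)) := h1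
  rw [hS] at h2
  simp [hij.symm] at h2

theorem ae_pi_restrict_injective (n : ℕ) (β : ℝ) :
    ∀ᵐ t ∂(Measure.pi fun _ : Fin n => (volume.restrict (Icc (0 : ℝ) β))),
      Function.Injective t ∧ ∀ i, t i ∈ Ioo 0 β := by
  rw [← Measure.restrict_pi_pi]
  have h1 : ∀ᵐ t : Fin n → ℝ ∂(Measure.pi fun _ : Fin n => (volume : Measure ℝ)),
      ∀ i j, i ≠ j → t i ≠ t j := by
    rw [ae_all_iff]; intro i
    rw [ae_all_iff]; intro j
    rw [ae_all_iff]; intro hij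
    have := volume_eq_coord hij
    rw [volume_pi] at this
    exact measure_mono_null (fun t ht => by simpa using ht) this
  have h2 : ∀ᵐ t : Fin n → ℝ ∂(Measure.pi fun _ : Fin n => (volume : Measure ℝ)),
      ∀ i, t i ≠ 0 ∧ t i ≠ β := by
    rw [ae_all_iff]; intro i
    exact (Measure.ae_eval_ne (μ := fun _ : Fin n => (volume : Measure ℝ)) i 0).and
      (Measure.ae_eval_ne (μ := fun _ : Fin n => (volume : Measure ℝ)) i β)
  filter_upwards [ae_restrict_of_ae h1, ae_restrict_of_ae h2,
    ae_restrict_mem (MeasurableSet.univ_pi fun _ => measurableSet_Icc)] with t ht1 ht2 ht3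
  refine ⟨fun i j hij => ?_, fun i => ?_⟩
  · by_contra h; exact ht1 i j h hij
  · have := ht3 i (mem_univ i)
    exact ⟨lt_of_le_of_ne this.1 (ht2 i).1.symm, lt_of_le_of_ne this.2 (ht2 i).2⟩

end Poisson

/-! ### Labels and times of a realization, and the law of its word -/

section Labels

variable {V : Type*} {G : SimpleGraph V}

/-- The two kinds of links, indexed by a boolean. -/
def boolEquivLinkKind : Bool ≃ LinkKind where
  toFun b := if b then .cross else .bar
  invFun k := match k with
    | .cross => true
    | .bar => false
  left_inv b := by cases b <;> rfl
  right_inv k := by cases k <;> rfl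

instance : Fintype LinkKind := Fintype.ofEquiv Bool boolEquivLinkKind

theorem sum_linkKind {M : Type*} [AddCommMonoid M] (f : LinkKind → M) :
    ∑ k, f k = f .cross + f .bar := by
  rw [← boolEquivLinkKind.sum_comp, Fintype.sum_bool]
  rfl

/-- The intensity of the links of a given kind. -/
def kindWeight (u : ℝ) : LinkKind → ℝ
  | .cross => u
  | .bar => 1 - u

theorem kindWeight_nonneg {u : ℝ} (hu0 : 0 ≤ u) (hu1 : u ≤ 1) (k : LinkKind) :
    0 ≤ kindWeight u k := by
  cases k
  · exact hu0
  · exact sub_nonneg.2 hu1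

/-- The intensity measure of the labels, per unit of time. -/
noncomputable def labelIntensity (G : SimpleGraph V) (u : ℝ) : Measure (Edge G × LinkKind) :=
  (Measure.count : Measure (Edge G)).prod
    (ENNReal.ofReal u • Measure.dirac LinkKind.cross +
      ENNReal.ofReal (1 - u) • Measure.dirac LinkKind.bar)

instance : DiscreteMeasurableSpace LinkKind := ⟨fun _ => trivial⟩

instance (G : SimpleGraph V) : DiscreteMeasurableSpace (Edge G) := ⟨fun _ => trivial⟩

/-- The realization with given labels and times. -/
def assemble (n : ℕ) :
    ((Fin n → Edge G × LinkKind) × (Fin n → ℝ)) ≃ᵐ (Fin n → Link G) :=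
  (MeasurableEquiv.arrowProdEquivProdArrow _ _ _).symm.trans
    (MeasurableEquiv.piCongrRight fun _ => MeasurableEquiv.prodAssoc)

/-- The labels in the order of their times. -/
noncomputable def sortedLabels {n : ℕ} (z : (Fin n → Edge G × LinkKind) × (Fin n → ℝ)) :
    Fin n → Edge G × LinkKind :=
  z.1 ∘ Tuple.sort z.2

/-- The word of a realization: the labels of its links, in the order of their times. -/
noncomputable def word (ω : Realization G) : Fin ω.1 → Edge G × LinkKind :=
  sortedLabels ((assemble ω.1).symm ω.2)

/-- A realization is regular if its links have different times in `(0, β)`. -/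
def IsRegular (β : ℝ) (ω : Realization G) : Prop :=
  Function.Injective ((assemble ω.1).symm ω.2).2 ∧ ∀ i, ((assemble ω.1).symm ω.2).2 i ∈ Ioo 0 β

theorem range_eq_linkSet (ω : Realization G) :
    range ω.2 = linkSet (word ω)
      (((assemble ω.1).symm ω.2).2 ∘ Tuple.sort ((assemble ω.1).symm ω.2).2) := by
  set z := (assemble ω.1).symm ω.2 with hz
  have h1 : ω.2 = assemble ω.1 z := by simp [hz]
  rw [linkSet, h1, ← (Tuple.sort z.2).surjective.range_comp]
  rfl

theorem IsRegular.strictMono {β : ℝ} {ω : Realization G} (h : IsRegular β ω) :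
    StrictMono (((assemble ω.1).symm ω.2).2 ∘ Tuple.sort ((assemble ω.1).symm ω.2).2) :=
  (Tuple.monotone_sort _).strictMono_of_injective (h.1.comp (Equiv.injective _))

section
variable [DecidableEq V]

theorem IsRegular.numLoops_eq {β : ℝ} (hβ : 0 ≤ β) {ω : Realization G} (h : IsRegular β ω) :
    numLoops β ω = wordLoops (word ω) := by
  rw [numLoops, range_eq_linkSet]
  exact ncard_loops h.strictMono (fun k => (h.2 _).1) (fun k => (h.2 _).2) hβ

theorem IsRegular.connected_iff {β : ℝ} (hβ : 0 ≤ β) {ω : Realization G} (h : IsRegular β ω)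
    (x y : V) (b c : Bool) : Connected β (range ω.2) (x, 0, b) (y, 0, c) ↔
      (wordPerm (word ω)).SameCycle (x, 0, b) (y, 0, c) := by
  rw [range_eq_linkSet]
  exact connected_zero_iff h.strictMono (fun k => (h.2 _).1) (fun k => (h.2 _).2) hβ x y b c

end

variable [Finite V]

instance : Finite (Edge G) := inferInstanceAs (Finite {e : Sym2 V // e ∈ G.edgeSet})

theorem measurable_sortedLabels (n : ℕ) : Measurable (sortedLabels (G := G) (n := n)) := by
  have h1 : Measurable fun z : (Fin n → Edge G × LinkKind) × (Fin n → ℝ) =>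
      (z.1, Tuple.sort z.2) := measurable_fst.prodMk ((measurable_sort n).comp measurable_snd)
  have : DiscreteMeasurableSpace (Equiv.Perm (Fin n)) := ⟨fun _ => trivial⟩
  have h2 : Measurable fun w : (Fin n → Edge G × LinkKind) × Equiv.Perm (Fin n) => w.1 ∘ w.2 :=
    Measurable.of_discrete
  exact h2.comp h1

theorem measurableSet_word (P : ∀ n : ℕ, (Fin n → Edge G × LinkKind) → Prop) :
    MeasurableSet {ω : Realization G | P ω.1 (word ω)} := by
  refine measurableSet_sigma fun n => ?_
  exact ((measurable_sortedLabels n).comp (assemble n).symm.measurable)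
    (MeasurableSet.of_discrete (s := {l | P n l}))

instance {X : Type*} [MeasurableSpace X] (a : ℝ) (x : X) :
    IsFiniteMeasure (ENNReal.ofReal a • Measure.dirac x) :=
  Measure.smul_finite _ ENNReal.ofReal_ne_top

instance (u : ℝ) : IsFiniteMeasure (labelIntensity G u) := by
  unfold labelIntensity
  infer_instance

/-- The intensity is a product, so the labels and the times of the links are independent. -/
theorem measurePreserving_assemble (β u : ℝ) (n : ℕ) :
    MeasurePreserving (assemble (G := G) n)
      ((Measure.pi fun _ : Fin n => labelIntensity G u).prod
        (Measure.pi fun _ : Fin n => volume.restrict (Icc (0 : ℝ) β)))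
      (Measure.pi fun _ : Fin n => linkIntensity G β u) := by
  refine MeasurePreserving.comp (g := MeasurableEquiv.piCongrRight fun _ => MeasurableEquiv.prodAssoc)
    (measurePreserving_pi _ _ fun _ => measurePreserving_prodAssoc _ _ _)
    (measurePreserving_arrowProdEquivProdArrow _ _ _ (fun _ => labelIntensity G u)
      (fun _ => volume.restrict (Icc (0 : ℝ) β))).symm

theorem ae_isRegular (β u : ℝ) : ∀ᵐ ω ∂(rho G β u), IsRegular β ω := by
  refine ae_poissonLaw _ fun n => ?_
  rw [← (measurePreserving_assemble β u n).map_eq, (assemble n).measurableEmbedding.ae_map_iff]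
  have h := (Measure.quasiMeasurePreserving_snd
    (μ := Measure.pi fun _ : Fin n => labelIntensity G u)).ae (ae_pi_restrict_injective n β)
  filter_upwards [h] with z hz
  simpa [IsRegular] using hz

theorem labelIntensity_singleton (u : ℝ) (a : Edge G × LinkKind) :
    labelIntensity G u {a} = ENNReal.ofReal (kindWeight u a.2) := by
  obtain ⟨e, k⟩ := a
  rw [← singleton_prod_singleton, labelIntensity, Measure.prod_prod, Measure.count_singleton,
    one_mul]
  cases k <;> simp [kindWeight]

theorem linkIntensity_univ [Fintype (Edge G)] {β u : ℝ} (hu0 : 0 ≤ u) (hu1 : u ≤ 1) :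
    linkIntensity G β u univ = Fintype.card (Edge G) * ENNReal.ofReal β := by
  rw [linkIntensity, ← univ_prod_univ, ← univ_prod_univ, Measure.prod_prod, Measure.prod_prod]
  simp only [Measure.coe_add, Measure.coe_smul, Pi.add_apply, Pi.smul_apply, measure_univ,
    smul_eq_mul, mul_one, MeasurableSet.univ, Measure.restrict_apply, univ_inter, Real.volume_Icc,
    sub_zero]
  rw [← ENNReal.ofReal_add hu0 (sub_nonneg.2 hu1), Measure.count_apply_finite _ finite_univ]
  simp

/-- For fixed times, sorting permutes the labels by a fixed permutation, which leaves a power of a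
single measure invariant. The times then contribute only their total mass `β ^ n`. -/
theorem lintegral_sortedLabels [Fintype (Edge G)] {β u : ℝ} (n : ℕ)
    (g : (Fin n → Edge G × LinkKind) → ℝ≥0∞) :
    ∫⁻ z, g (sortedLabels z) ∂((Measure.pi fun _ : Fin n => labelIntensity G u).prod
        (Measure.pi fun _ : Fin n => volume.restrict (Icc (0 : ℝ) β))) =
      ENNReal.ofReal β ^ n * ∑ l, (∏ k, ENNReal.ofReal (kindWeight u (l k).2)) * g l := by
  classical
  have hg : Measurable g := Measurable.of_discrete
  rw [lintegral_prod_symm (fun z => g (sortedLabels z))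
    (hg.comp (measurable_sortedLabels n)).aemeasurable]
  have h : ∀ t : Fin n → ℝ, ∫⁻ l, g (sortedLabels (l, t))
      ∂(Measure.pi fun _ : Fin n => labelIntensity G u) =
        ∑ l, (∏ k, ENNReal.ofReal (kindWeight u (l k).2)) * g l := by
    intro t
    rw [lintegral_fintype, ← Equiv.sum_comp
      (Equiv.arrowCongr (Tuple.sort t) (Equiv.refl (Edge G × LinkKind)))]
    refine Finset.sum_congr rfl fun l _ => ?_
    rw [Measure.pi_singleton, mul_comm]
    congr 1
    · simp only [labelIntensity_singleton, Equiv.arrowCongr_apply, Function.comp_apply,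
        Equiv.refl_apply]
      exact (Tuple.sort t).symm.prod_comp fun k => ENNReal.ofReal (kindWeight u (l k).2)
    · congr 1
      funext k
      simp [sortedLabels]
  simp only [h, lintegral_const]
  rw [← pi_univ univ, Measure.pi_pi]
  simp [mul_comm]

/-- The probability density of a word under the Poisson point measure. -/
noncomputable def wordMass [Fintype (Edge G)] (β u : ℝ) {n : ℕ} (l : Fin n → Edge G × LinkKind) :
    ℝ :=
  Real.exp (-(Fintype.card (Edge G) * β)) * ((n ! : ℝ)⁻¹ * (β ^ n * ∏ k, kindWeight u (l k).2))

omit [Finite V] in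
theorem wordMass_nonneg [Fintype (Edge G)] {β u : ℝ} (hβ : 0 ≤ β) (hu0 : 0 ≤ u) (hu1 : u ≤ 1)
    {n : ℕ} (l : Fin n → Edge G × LinkKind) : 0 ≤ wordMass β u l :=
  mul_nonneg (Real.exp_nonneg _) (mul_nonneg (by positivity) (mul_nonneg (pow_nonneg hβ _)
    (Finset.prod_nonneg fun _ _ => kindWeight_nonneg hu0 hu1 _)))

/-- The Poisson weight of `n` links has exponent `|E| β`, the total intensity, because `u + (1 - u)
= 1` on every edge. -/
theorem lintegral_rho [Fintype (Edge G)] {β u : ℝ} (hβ : 0 ≤ β) (hu0 : 0 ≤ u) (hu1 : u ≤ 1)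
    (g : ∀ n : ℕ, (Fin n → Edge G × LinkKind) → ℝ≥0∞) :
    ∫⁻ ω, g ω.1 (word ω) ∂(rho G β u) =
      ∑' n : ℕ, ∑ l, ENNReal.ofReal (wordMass β u l) * g n l := by
  rw [rho, lintegral_poissonLaw]
  refine tsum_congr fun n => ?_
  rw [← (measurePreserving_assemble β u n).map_eq,
    (assemble n).measurableEmbedding.lintegral_map]
  have h : ∀ z : (Fin n → Edge G × LinkKind) × (Fin n → ℝ),
      word (⟨n, assemble n z⟩ : Realization G) = sortedLabels z := fun z => by simp [word]
  simp only [h]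
  rw [lintegral_sortedLabels, linkIntensity_univ hu0 hu1, Finset.mul_sum, Finset.mul_sum]
  refine Finset.sum_congr rfl fun l _ => ?_
  rw [wordMass, ENNReal.ofReal_mul (Real.exp_nonneg _), ENNReal.ofReal_mul (by positivity),
    ENNReal.ofReal_mul (pow_nonneg hβ _), ENNReal.ofReal_prod_of_nonneg
      (fun _ _ => kindWeight_nonneg hu0 hu1 _), ENNReal.ofReal_pow hβ,
    ENNReal.ofReal_inv_of_pos (by positivity), ENNReal.ofReal_natCast, ENNReal.toReal_mul,
    ENNReal.toReal_natCast, ENNReal.toReal_ofReal hβ, div_eq_mul_inv]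
  ring

end Labels

/-! ### Expansion of the Gibbs operator -/

section Expansion

variable {V : Type*} [Fintype V] [DecidableEq V] {G : SimpleGraph V} [DecidableRel G.Adj]

theorem sum_pow_eq_sum_ofFn_prod {ι R : Type*} [Fintype ι] [Semiring R] (f : ι → R) (n : ℕ) :
    (∑ a, f a) ^ n = ∑ l : Fin n → ι, (List.ofFn fun k => f (l k)).prod := by
  classical
  induction n with
  | zero => simp
  | succ n ih =>
    rw [pow_succ', ih, Finset.sum_mul_sum, ← (Fin.consEquiv fun _ : Fin (n + 1) => ι).sum_comp,
      Fintype.sum_prod_type]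
    refine Finset.sum_congr rfl fun a _ => Finset.sum_congr rfl fun l _ => ?_
    simp [Fin.consEquiv, List.ofFn_succ]

theorem ofFn_smul_prod {d n : ℕ} (w : Fin n → ℂ) (O : Fin n → Op V d) :
    (List.ofFn fun k => w k • O k).prod = (∏ k, w k) • (List.ofFn O).prod := by
  induction n with
  | zero => simp
  | succ n ih =>
    rw [List.ofFn_succ, List.ofFn_succ, List.prod_cons, List.prod_cons, ih, Fin.prod_univ_succ,
      smul_mul_smul_comm]

/-- The sum of the operators of the links, with their intensities. -/
def transferOp (G : SimpleGraph V) [DecidableRel G.Adj] (d : ℕ) (u : ℝ) : Op V d :=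
  ∑ a : Edge G × LinkKind, (kindWeight u a.2 : ℂ) • labelOp d a

theorem transferOp_pow (d : ℕ) (u : ℝ) (n : ℕ) : transferOp G d u ^ n =
    ∑ l : Fin n → Edge G × LinkKind, ((∏ k, kindWeight u (l k).2 : ℝ) : ℂ) • wordOp d l := by
  rw [transferOp, sum_pow_eq_sum_ofFn_prod]
  refine Finset.sum_congr rfl fun l _ => ?_
  rw [ofFn_smul_prod, wordOp, Complex.ofReal_prod]

theorem hamiltonian_eq (d : ℕ) (u : ℝ) : hamiltonian G d u =
    (Fintype.card (Edge G) : ℂ) • (1 : Op V d) - transferOp G d u := by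
  have h1 : ∀ e : Edge G, edgeOp d u (e : Sym2 V) =
      ∑ k : LinkKind, (kindWeight u k : ℂ) • labelOp d (e, k) - 1 := by
    rintro ⟨e, he⟩
    induction e using Sym2.ind with
    | _ x y => simp only [edgeOp, sum_linkKind, kindWeight, labelOp, Sym2.lift_mk]
  rw [hamiltonian, transferOp, Fintype.sum_prod_type,
    Finset.sum_subtype (F := inferInstanceAs (Fintype (Edge G))) G.edgeFinset
      (fun e => SimpleGraph.mem_edgeFinset) (edgeOp d u)]
  rw [Finset.sum_congr rfl fun e _ => h1 e, Finset.sum_sub_distrib, neg_sub]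
  simp [Nat.cast_smul_eq_nsmul]

theorem hasSum_trace_mul_exp {ι : Type*} [Fintype ι] [DecidableEq ι] (M A : Matrix ι ι ℂ) :
    HasSum (fun n : ℕ => (n ! : ℂ)⁻¹ * (M * A ^ n).trace) (M * NormedSpace.exp A).trace := by
  -- The norm only serves to sum the exponential series; the trace against `M` is linear in finite
  -- dimension, hence continuous.
  let : NormedRing (Matrix ι ι ℂ) := Matrix.linftyOpNormedRing
  let : NormedAlgebra ℂ (Matrix ι ι ℂ) := Matrix.linftyOpNormedAlgebra
  have h := NormedSpace.exp_series_hasSum_exp' (𝕂 := ℂ) A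
  let L : Matrix ι ι ℂ →ₗ[ℂ] ℂ := Matrix.traceLinearMap ι ℂ ℂ ∘ₗ LinearMap.mulLeft ℂ M
  have h2 := h.map L.toContinuousLinearMap L.toContinuousLinearMap.continuous
  have h3 : ∀ n : ℕ, (L.toContinuousLinearMap : Matrix ι ι ℂ → ℂ) ((n ! : ℂ)⁻¹ • A ^ n) =
      (n ! : ℂ)⁻¹ * (M * A ^ n).trace := fun n => by simp [L]
  rwa [← funext h3]

theorem exp_smul_one {ι : Type*} [Fintype ι] [DecidableEq ι] (c : ℂ) :
    NormedSpace.exp (c • (1 : Matrix ι ι ℂ)) = Complex.exp c • (1 : Matrix ι ι ℂ) := by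
  let : NormedRing (Matrix ι ι ℂ) := Matrix.linftyOpNormedRing
  let : NormedAlgebra ℂ (Matrix ι ι ℂ) := Matrix.linftyOpNormedAlgebra
  have h := NormedSpace.algebraMap_exp_comm (𝕂 := ℂ) (𝔸 := Matrix ι ι ℂ) c
  rw [Algebra.algebraMap_eq_smul_one, Algebra.algebraMap_eq_smul_one, ← Complex.exp_eq_exp_ℂ] at h
  exact h.symm

/-- The constant `-1` of each edge commutes with everything and yields precisely the normalization
of the Poisson law. -/
theorem gibbsOp_eq (d : ℕ) (β u : ℝ) : gibbsOp G d β u =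
    (Real.exp (-(Fintype.card (Edge G) * β)) : ℂ) •
      NormedSpace.exp ((β : ℂ) • transferOp G d u) := by
  have h : -((β : ℂ) • hamiltonian G d u) = (β : ℂ) • transferOp G d u +
      (-(Fintype.card (Edge G) * β) : ℂ) • (1 : Op V d) := by
    rw [hamiltonian_eq, smul_sub, smul_smul, neg_smul, mul_comm]
    abel
  rw [gibbsOp, h, Matrix.exp_add_of_commute _ _ ((Commute.one_right _).smul_right _), exp_smul_one,
    mul_smul_comm, mul_one]
  push_cast
  rfl

/-- The `n`-th power of `transferOp` expands over words of length `n`; with `β ^ n / n !` and the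
exponential prefactor, the coefficients are the Poisson masses. -/
theorem hasSum_trace_mul_gibbsOp (d : ℕ) (β u : ℝ) (M : Op V d) :
    HasSum (fun n : ℕ => ∑ l : Fin n → Edge G × LinkKind,
      (wordMass β u l : ℂ) * (M * wordOp d l).trace) (M * gibbsOp G d β u).trace := by
  rw [gibbsOp_eq, mul_smul_comm, Matrix.trace_smul, smul_eq_mul]
  have h : ∀ n : ℕ, ∑ l : Fin n → Edge G × LinkKind, (wordMass β u l : ℂ) * (M * wordOp d l).trace =
      (Real.exp (-(Fintype.card (Edge G) * β)) : ℂ) *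
        ((n ! : ℂ)⁻¹ * (M * ((β : ℂ) • transferOp G d u) ^ n).trace) := by
    intro n
    rw [smul_pow, transferOp_pow, mul_smul_comm, Matrix.trace_smul, Finset.mul_sum,
      Matrix.trace_sum, smul_eq_mul, Finset.mul_sum, Finset.mul_sum, Finset.mul_sum]
    refine Finset.sum_congr rfl fun l _ => ?_
    rw [mul_smul_comm, Matrix.trace_smul, smul_eq_mul, wordMass]
    push_cast
    ring
  rw [funext h]
  exact (hasSum_trace_mul_exp M _).mul_left _

end Expansion

/-! ### The random loop measure -/

section LoopMeasure

variable {V : Type*} [Fintype V] [DecidableEq V] {G : SimpleGraph V} [DecidableRel G.Adj]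
  {d : ℕ} {β u : ℝ}

/-- The contribution of the words of length `n` that satisfy `P` to the partition function. -/
noncomputable def wordSum (G : SimpleGraph V) [DecidableRel G.Adj] (d : ℕ) (β u : ℝ)
    (P : ∀ n : ℕ, (Fin n → Edge G × LinkKind) → Prop) (n : ℕ) : ℝ :=
  open Classical in ∑ l : Fin n → Edge G × LinkKind,
    wordMass β u l * ((d : ℝ) ^ wordLoops l * if P n l then 1 else 0)

variable (hβ : 0 ≤ β) (hu0 : 0 ≤ u) (hu1 : u ≤ 1)
include hβ hu0 hu1

theorem wordSum_nonneg (P : ∀ n : ℕ, (Fin n → Edge G × LinkKind) → Prop) (n : ℕ) :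
    0 ≤ wordSum G d β u P n := by
  refine Finset.sum_nonneg fun l _ => mul_nonneg (wordMass_nonneg hβ hu0 hu1 l)
    (mul_nonneg (by positivity) ?_)
  split_ifs <;> simp

theorem wordSum_le (P : ∀ n : ℕ, (Fin n → Edge G × LinkKind) → Prop) (n : ℕ) :
    wordSum G d β u P n ≤ wordSum G d β u (fun _ _ => True) n := by
  refine Finset.sum_le_sum fun l _ => mul_le_mul_of_nonneg_left
    (mul_le_mul_of_nonneg_left ?_ (by positivity)) (wordMass_nonneg hβ hu0 hu1 l)
  by_cases h : P n l <;> simp [h]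

omit hβ hu0 hu1 in
theorem hasSum_partitionFunction : HasSum (fun n => (wordSum G d β u (fun _ _ => True) n : ℂ))
    (partitionFunction G d β u) := by
  have h := hasSum_trace_mul_gibbsOp (G := G) d β u 1
  simpa [wordSum, trace_wordOp, partitionFunction] using h

omit hβ hu0 hu1 in
theorem hasSum_partitionFunction_re : HasSum (wordSum G d β u fun _ _ => True)
    (partitionFunction G d β u).re := by
  simpa using Complex.hasSum_re hasSum_partitionFunction

omit hβ hu0 hu1 in
theorem partitionFunction_eq_re :
    partitionFunction G d β u = ((partitionFunction G d β u).re : ℂ) :=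
  hasSum_partitionFunction.unique (Complex.hasSum_ofReal.2 hasSum_partitionFunction_re)

theorem partitionFunction_re_pos (hd : 1 ≤ d) : 0 < (partitionFunction G d β u).re := by
  -- The empty word alone has positive weight.
  refine lt_of_lt_of_le ?_ (le_hasSum hasSum_partitionFunction_re 0 fun n _ =>
    wordSum_nonneg hβ hu0 hu1 _ n)
  refine Finset.sum_pos (fun l _ => ?_) Finset.univ_nonempty
  have : 0 < d := hd
  simp only [wordMass, pow_zero, Finset.univ_eq_empty, Finset.prod_empty, if_true]
  positivity

theorem summable_wordSum (P : ∀ n : ℕ, (Fin n → Edge G × LinkKind) → Prop) :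
    Summable (wordSum G d β u P) :=
  Summable.of_nonneg_of_le (wordSum_nonneg hβ hu0 hu1 P) (wordSum_le hβ hu0 hu1 P)
    hasSum_partitionFunction_re.summable

omit [DecidableRel G.Adj] hu0 hu1 in
theorem ae_numLoops : ∀ᵐ ω ∂(rho G β u), numLoops β ω = wordLoops (word ω) := by
  filter_upwards [ae_isRegular β u] with ω hω using hω.numLoops_eq hβ

-- Exceptional realizations (coinciding times, or times outside `(0, β)`) are null, and elsewhere
-- the event is read off the word.
omit [DecidableRel G.Adj] hu0 hu1 in
theorem eventPlus_ae_eq (x y : V) : eventPlus G β x y =ᵐ[rho G β u]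
    {ω | (wordPerm (word ω)).SameCycle (x, 0, true) (y, 0, true)} := by
  filter_upwards [ae_isRegular β u] with ω hω
  exact propext (hω.connected_iff hβ x y true true)

omit [DecidableRel G.Adj] hu0 hu1 in
theorem eventMinus_ae_eq (x y : V) : eventMinus G β x y =ᵐ[rho G β u]
    {ω | (wordPerm (word ω)).SameCycle (x, 0, true) (y, 0, false)} := by
  filter_upwards [ae_isRegular β u] with ω hω
  exact propext (hω.connected_iff hβ x y true false)

omit hβ hu0 hu1 in
theorem loopMeasure_absolutelyContinuous :
    loopMeasure G d β u ≪ rho G β u :=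
  (withDensity_absolutelyContinuous _ _).smul_left _

/-- The density `d ^ numLoops` is almost everywhere a function of the word, so its integral is a
series over words. -/
theorem loopMeasure_word (P : ∀ n : ℕ, (Fin n → Edge G × LinkKind) → Prop) :
    loopMeasure G d β u {ω | P ω.1 (word ω)} =
      ENNReal.ofReal (partitionFunction G d β u).re⁻¹ *
        ENNReal.ofReal (∑' n, wordSum G d β u P n) := by
  classical
  have hP := measurableSet_word P
  rw [loopMeasure, Measure.smul_apply, smul_eq_mul, withDensity_apply _ hP,
    ← lintegral_indicator hP]
  congr 1
  have h : ∀ᵐ ω ∂(rho G β u), {ω : Realization G | P ω.1 (word ω)}.indicator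
      (fun ω => (d : ℝ≥0∞) ^ numLoops β ω) ω =
        ENNReal.ofReal ((d : ℝ) ^ wordLoops (word ω) * if P ω.1 (word ω) then 1 else 0) := by
    filter_upwards [ae_numLoops (G := G) (u := u) hβ] with ω hω
    by_cases hPω : P ω.1 (word ω)
    · rw [indicator_of_mem (by exact hPω), if_pos hPω, hω, mul_one,
        ENNReal.ofReal_pow (Nat.cast_nonneg _), ENNReal.ofReal_natCast]
    · rw [indicator_of_notMem (by exact hPω), if_neg hPω, mul_zero, ENNReal.ofReal_zero]
  rw [lintegral_congr_ae h, lintegral_rho hβ hu0 hu1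
    (fun n l => ENNReal.ofReal ((d : ℝ) ^ wordLoops l * if P n l then 1 else 0)),
    ENNReal.ofReal_tsum_of_nonneg (wordSum_nonneg hβ hu0 hu1 P) (summable_wordSum hβ hu0 hu1 P)]
  refine tsum_congr fun n => ?_
  rw [wordSum, ENNReal.ofReal_sum_of_nonneg]
  · refine Finset.sum_congr rfl fun l _ => ?_
    rw [ENNReal.ofReal_mul (wordMass_nonneg hβ hu0 hu1 l)]
  · intro l _
    refine mul_nonneg (wordMass_nonneg hβ hu0 hu1 l) (mul_nonneg (by positivity) ?_)
    split_ifs <;> simp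

theorem isProbabilityMeasure_loopMeasure (hd : 1 ≤ d) :
    IsProbabilityMeasure (loopMeasure G d β u) := by
  constructor
  have h := loopMeasure_word (G := G) (d := d) hβ hu0 hu1 fun _ _ => True
  have hZ := partitionFunction_re_pos (G := G) hβ hu0 hu1 hd
  rw [hasSum_partitionFunction_re.tsum_eq, ← ENNReal.ofReal_mul (inv_nonneg.2 hZ.le),
    inv_mul_cancel₀ hZ.ne', ENNReal.ofReal_one] at h
  exact h

/-- Multiplying by the partition function clears the normalization and puts probabilities in the
same form as the expansion of the traces. -/
theorem hasSum_wordSum (hd : 1 ≤ d) {E : Set (Realization G)}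
    {P : ∀ n : ℕ, (Fin n → Edge G × LinkKind) → Prop}
    (hE : E =ᵐ[rho G β u] {ω | P ω.1 (word ω)}) :
    HasSum (fun n => (wordSum G d β u P n : ℂ))
      (partitionFunction G d β u * ((loopMeasure G d β u).real E : ℂ)) := by
  have hZ := partitionFunction_re_pos (G := G) hβ hu0 hu1 hd
  rw [partitionFunction_eq_re, ← Complex.ofReal_mul, Complex.hasSum_ofReal]
  rw [Measure.real, measure_congr (loopMeasure_absolutelyContinuous.ae_eq hE),
    loopMeasure_word hβ hu0 hu1, ENNReal.toReal_mul, ENNReal.toReal_ofReal (inv_nonneg.2 hZ.le),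
    ENNReal.toReal_ofReal (tsum_nonneg (wordSum_nonneg hβ hu0 hu1 P)),
    mul_inv_cancel_left₀ hZ.ne']
  exact (summable_wordSum hβ hu0 hu1 P).hasSum

theorem gibbsState_siteOp (hd : 1 ≤ d) (x : V) (A : Matrix (Fin d) (Fin d) ℂ) :
    gibbsState G d β u (siteOp x A) = A.trace / d := by
  have hZ := partitionFunction_re_pos (G := G) hβ hu0 hu1 hd
  have hZ' : partitionFunction G d β u ≠ 0 := fun h => by simp [h] at hZ
  rw [gibbsState, div_eq_iff hZ', mul_comm]
  refine (hasSum_trace_mul_gibbsOp d β u (siteOp x A)).unique ?_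
  have h : ∀ n : ℕ, ∑ l : Fin n → Edge G × LinkKind,
      (wordMass β u l : ℂ) * (siteOp x A * wordOp d l).trace =
        (wordSum G d β u (fun _ _ => True) n : ℂ) * (A.trace / d) := by
    intro n
    simp only [wordSum, trace_siteOp_mul_wordOp hd, if_true, mul_one, Complex.ofReal_sum,
      Finset.sum_mul]
    refine Finset.sum_congr rfl fun l _ => ?_
    push_cast
    ring
  rw [funext h]
  exact hasSum_partitionFunction.mul_right _

/-- After clearing the denominator both sides are sums of series over the word length, and
uniqueness of sums reduces the claim to the trace formula for each word. -/
theorem gibbsState_siteOp_mul_siteOp (hd : 1 ≤ d) {x y : V} (hxy : x ≠ y)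
    (A B : Matrix (Fin d) (Fin d) ℂ) :
    gibbsState G d β u (siteOp x A * siteOp y B) =
      (A * B).trace / d * ((loopMeasure G d β u).real (eventPlus G β x y) : ℂ) +
      (A * Bᵀ).trace / d * ((loopMeasure G d β u).real (eventMinus G β x y) : ℂ) +
      A.trace * B.trace / (d : ℂ) ^ 2 *
        ((loopMeasure G d β u).real (eventSame G β x y)ᶜ : ℂ) := by
  classical
  have hZ := partitionFunction_re_pos (G := G) hβ hu0 hu1 hd
  have hZ' : partitionFunction G d β u ≠ 0 := fun h => by simp [h] at hZ
  have h1 := hasSum_wordSum hβ hu0 hu1 hd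
    (P := fun n l => (wordPerm l).SameCycle (x, 0, true) (y, 0, true))
    (eventPlus_ae_eq (G := G) (u := u) hβ x y)
  have h2 := hasSum_wordSum hβ hu0 hu1 hd
    (P := fun n l => (wordPerm l).SameCycle (x, 0, true) (y, 0, false))
    (eventMinus_ae_eq (G := G) (u := u) hβ x y)
  have h3 := hasSum_wordSum hβ hu0 hu1 hd
    (P := fun n l => ¬ ((wordPerm l).SameCycle (x, 0, true) (y, 0, true) ∨
      (wordPerm l).SameCycle (x, 0, true) (y, 0, false)))
    ((eventPlus_ae_eq (G := G) (u := u) hβ x y).union (eventMinus_ae_eq hβ x y)).compl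
  rw [gibbsState, div_eq_iff hZ']
  refine (hasSum_trace_mul_gibbsOp d β u _).unique ?_
  have h : ∀ n : ℕ, ∑ l : Fin n → Edge G × LinkKind,
      (wordMass β u l : ℂ) * (siteOp x A * siteOp y B * wordOp d l).trace =
        (A * B).trace / d * (wordSum G d β u
          (fun n l => (wordPerm l).SameCycle (x, 0, true) (y, 0, true)) n : ℂ) +
        (A * Bᵀ).trace / d * (wordSum G d β u
          (fun n l => (wordPerm l).SameCycle (x, 0, true) (y, 0, false)) n : ℂ) +
        A.trace * B.trace / (d : ℂ) ^ 2 * (wordSum G d β u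
          (fun n l => ¬ ((wordPerm l).SameCycle (x, 0, true) (y, 0, true) ∨
            (wordPerm l).SameCycle (x, 0, true) (y, 0, false))) n : ℂ) := by
    intro n
    simp only [wordSum, trace_siteOp_mul_siteOp_mul_wordOp hd hxy, Complex.ofReal_sum,
      Finset.mul_sum, ← Finset.sum_add_distrib]
    refine Finset.sum_congr rfl fun l _ => ?_
    rcases Classical.em ((wordPerm l).SameCycle (x, 0, true) (y, 0, true)) with h4 | h4 <;>
      rcases Classical.em ((wordPerm l).SameCycle (x, 0, true) (y, 0, false)) with h5 | h5 <;>
      simp only [h4, h5, if_true, if_false, or_self, or_true, true_or, not_true_eq_false,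
        not_false_eq_true] <;>
      push_cast <;> ring
  rw [funext h]
  have h6 := ((h1.mul_left ((A * B).trace / d)).add (h2.mul_left ((A * Bᵀ).trace / d))).add
    (h3.mul_left (A.trace * B.trace / (d : ℂ) ^ 2))
  have h7 : ∀ a b c p q r z : ℂ, (a * p + b * q + c * r) * z = a * (z * p) + b * (z * q) +
      c * (z * r) := fun a b c p q r z => by ring
  rw [h7]
  exact h6

/-- Additivity is applied to the word versions of the two events, which are measurable, and disjoint
by `wordPerm_not_both`. -/
theorem measureReal_eventSame (hd : 1 ≤ d) (x y : V) :
    (loopMeasure G d β u).real (eventSame G β x y) =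
      (loopMeasure G d β u).real (eventPlus G β x y) +
        (loopMeasure G d β u).real (eventMinus G β x y) := by
  have := isProbabilityMeasure_loopMeasure (G := G) hβ hu0 hu1 hd
  have h1 : eventPlus G β x y =ᵐ[loopMeasure G d β u] _ :=
    loopMeasure_absolutelyContinuous.ae_eq (eventPlus_ae_eq hβ x y)
  have h2 : eventMinus G β x y =ᵐ[loopMeasure G d β u] _ :=
    loopMeasure_absolutelyContinuous.ae_eq (eventMinus_ae_eq hβ x y)
  rw [eventSame, measureReal_congr (h1.union h2), measureReal_congr h1, measureReal_congr h2]
  refine measureReal_union (Set.disjoint_left.2 fun ω hω hω' => ?_)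
    (measurableSet_word fun _ l => (wordPerm l).SameCycle (x, 0, true) (y, 0, false))
  exact wordPerm_not_both (word ω) hω hω'

end LoopMeasure

end RandomLoop

open RandomLoop

/-! ### The theorem, and its specialization to spin 1/2 -/

theorem theorem5p1 {V : Type*} [Fintype V] [DecidableEq V] (G : SimpleGraph V)
    [DecidableRel G.Adj] (β u : ℝ) (hβ : 0 ≤ β) (hu0 : 0 ≤ u) (hu1 : u ≤ 1) :
    (∀ d : ℕ, 1 ≤ d →
      IsProbabilityMeasure (loopMeasure G d β u) ∧
      (∀ x y : V, x ≠ y →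
        NullMeasurableSet (eventPlus G β x y) (loopMeasure G d β u) ∧
        NullMeasurableSet (eventMinus G β x y) (loopMeasure G d β u) ∧
        ∀ A B : Matrix (Fin d) (Fin d) ℂ,
          gibbsState G d β u (siteOp x A * siteOp y B) =
            (A * B).trace / d * ((loopMeasure G d β u).real (eventPlus G β x y) : ℂ) +
            (A * Bᵀ).trace / d * ((loopMeasure G d β u).real (eventMinus G β x y) : ℂ) +
            A.trace * B.trace / (d : ℂ) ^ 2 *
              ((loopMeasure G d β u).real (eventSame G β x y)ᶜ : ℂ)) ∧
      (∀ (x : V) (A : Matrix (Fin d) (Fin d) ℂ),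
        gibbsState G d β u (siteOp x A) = A.trace / d)) ∧
    (∀ x y : V, x ≠ y →
      gibbsState G 2 β u (siteOp x spinHalf1 * siteOp y spinHalf1) =
        1 / 4 * ((loopMeasure G 2 β u).real (eventSame G β x y) : ℂ) ∧
      gibbsState G 2 β u (siteOp x spinHalf2 * siteOp y spinHalf2) =
        1 / 4 * (((loopMeasure G 2 β u).real (eventPlus G β x y) : ℂ) -
          ((loopMeasure G 2 β u).real (eventMinus G β x y) : ℂ)) ∧
      gibbsState G 2 β u (siteOp x spinHalf3 * siteOp y spinHalf3) =
        1 / 4 * ((loopMeasure G 2 β u).real (eventSame G β x y) : ℂ)) := by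
  refine ⟨fun d hd => ⟨isProbabilityMeasure_loopMeasure hβ hu0 hu1 hd, fun x y hxy =>
    ⟨?_, ?_, gibbsState_siteOp_mul_siteOp hβ hu0 hu1 hd hxy⟩,
    gibbsState_siteOp hβ hu0 hu1 hd⟩, fun x y hxy => ?_⟩
  · exact (measurableSet_word fun _ l =>
      (wordPerm l).SameCycle (x, 0, true) (y, 0, true)).nullMeasurableSet.congr
        (loopMeasure_absolutelyContinuous.ae_eq (eventPlus_ae_eq hβ x y)).symm
  · exact (measurableSet_word fun _ l =>
      (wordPerm l).SameCycle (x, 0, true) (y, 0, false)).nullMeasurableSet.congr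
        (loopMeasure_absolutelyContinuous.ae_eq (eventMinus_ae_eq hβ x y)).symm
  -- Spin matrices are traceless, which removes the last term, and their squares have trace `1/2`.
  -- Transposition fixes the first and the third and changes the sign of the second.
  · have h := gibbsState_siteOp_mul_siteOp (G := G) hβ hu0 hu1 one_le_two hxy
    have hE := measureReal_eventSame (G := G) hβ hu0 hu1 one_le_two x y
    refine ⟨?_, ?_, ?_⟩
    · rw [h, hE]
      simp only [spinHalf1, Matrix.trace_fin_two, Matrix.mul_fin_two, Matrix.transpose_apply,
        Matrix.mul_apply, Fin.sum_univ_two]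
      simp
      ring
    · rw [h]
      simp only [spinHalf2, Matrix.trace_fin_two, Matrix.mul_fin_two, Matrix.transpose_apply,
        Matrix.mul_apply, Fin.sum_univ_two]
      simp
      ring_nf
      simp
      ring
    · rw [h, hE]
      simp only [spinHalf3, Matrix.trace_fin_two, Matrix.mul_fin_two, Matrix.transpose_apply,
        Matrix.mul_apply, Fin.sum_univ_two]
      simp
      ring
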